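/- **Proposition 5.** Let $\alpha_1,\beta_1\in\mathbb R$, $\tau\in\mathbb H$ (the upper half plane), $q=e^{2\pi i\tau}$ (with $q^c=e^{2\pi i\tau c}$), and $\kappa\in(-\tfrac12,\tfrac12)$. Let $M$ be the Heisenberg Fock space with modes $[a(m),a(n)]=m\,\delta_{m,-n}$. For $\mu\in\mathbb C$ let $M\otimes e^{\mu}$ be its irreducible module on which $a(0)=\mu$, and $L(0)=\tfrac12a(0)^2+\sum_{n\ge1}a(-n)a(n)$. Let $e^{\beta\hat q}:M\otimes e^\mu\to M\otimes e^{\mu+\beta}$ be the charge shift $u\otimes e^{\mu}\mapsto u\otimes e^{\mu+\beta}$. For the vector $e^\beta=\mathbf 1\otimes e^\beta$ put $$\mathcal Y(e^\beta,z)=e^{\beta\hat q}\exp\Big(\beta\sum_{n>0}\tfrac{a(-n)}{n}z^{n}\Big)\exp\Big(-\beta\sum_{n>0}\tfrac{a(n)}{n}z^{-n}\Big)z^{\beta a(0)} .$$ With $V_{\mathbb Z+\alpha_1}=\bigoplus_{m\in\mathbb Z}M\otimes e^{m+\alpha_1}$, $\sigma f_1=e^{2\pi i\beta_1a(0)}$,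 $\sigma g_1=e^{-2\pi i\alpha_1 a(0)}$, $q_i=e^{z_i}$ and $q_i^{c}=e^{cz_i}$, define the torus orbifold intertwining functions $$Z^{(1)}\begin{bmatrix}f_1\\ g_1\end{bmatrix}(e^{\gamma_1},z_1;\dots;e^{\gamma_r},z_r;q)=\mathrm{Tr}_{V_{\mathbb Z+\alpha_1}}\Big(\sigma f_1\,\mathcal Y(q_1^{L(0)}e^{\gamma_1},q_1)\cdots\mathcal Y(q_r^{L(0)}e^{\gamma_r},q_r)\,q^{L(0)-1/24}\Big),$$ and, with $\psi^{\pm}=e^{\pm1}$, the generating form $$\mathcal G^{(1)}_n\begin{bmatrix}f_1\\ g_1\end{bmatrix}(x_1,y_1,\dots,x_n,y_n)=Z^{(1)}\begin{bmatrix}f_1\\ g_1\end{bmatrix}(\psi^+,x_1;\psi^-,y_1;\dots;\psi^+,x_n;\psi^-,y_n;e^{\kappa},w;e^{-\kappa},0;q)\prod_{i=1}^n dx_i^{1/2}dy_i^{1/2},$$ where $dx_i^{1/2},dy_j^{1/2}$ are commuting formal symbols. Let $$\vartheta\begin{bmatrix}\alpha\\ \beta\end{bmatrix}(z,\tau)=\sum_{n\in\mathbb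 Z}e^{i\pi(n+\alpha)^2\tau+(n+\alpha)(z+2\pi i\beta)},\qquad \vartheta_1=\vartheta\begin{bmatrix}1/2\\ 1/2\end{bmatrix},\qquad K(z,\tau)=\frac{\vartheta_1(z,\tau)}{\partial_z\vartheta_1(0,\tau)},$$ and let the $\kappa$-twisted torus Szegő kernel be $$S_\kappa(x,y)=\left(\frac{\vartheta_1(x-w,\tau)\,\vartheta_1(y,\tau)}{\vartheta_1(x,\tau)\,\vartheta_1(y-w,\tau)}\right)^{\kappa}\frac{\vartheta\begin{bmatrix}\alpha_1\\ \beta_1\end{bmatrix}(x-y+\kappa w,\tau)}{\vartheta\begin{bmatrix}\alpha_1\\ \beta_1\end{bmatrix}(\kappa w,\tau)\,K(x-y,\tau)}\,dx^{1/2}dy^{1/2},$$ where the $\kappa$-th power is formed with a continuous branch of $\log\vartheta_1(\cdot,\tau)$ on the strip $0<\mathrm{Re}\,z<2\pi\,\mathrm{Im}\,\tau$; such a branch exists, and the power does not depend on its choice. Assume $\vartheta\begin{bmatrix}\alpha_1\\ \beta_1\end{bmatrix}(\kappa w,\tau)\neq0$. Then for every $n\ge0$ and all $x_i,y_i,w\in\mathbb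 C$ in the domain $$2\pi\,\mathrm{Im}\,\tau>\mathrm{Re}\,x_1>\mathrm{Re}\,y_1>\dots>\mathrm{Re}\,x_n>\mathrm{Re}\,y_n>\mathrm{Re}\,w>0$$ the series defining $\mathcal G^{(1)}_n$ and $Z^{(1)}(e^\kappa,w;e^{-\kappa},0;q)$ converge absolutely, and $$\mathcal G^{(1)}_n\begin{bmatrix}f_1\\ g_1\end{bmatrix}(x_1,y_1,\dots,x_n,y_n)=Z^{(1)}\begin{bmatrix}f_1\\ g_1\end{bmatrix}(e^{\kappa},w;e^{-\kappa},0;q)\,\det S_\kappa ,$$ where $S_\kappa$ denotes the $n\times n$ matrix with entries $S_\kappa(x_i,y_j)$, $i,j=1,\dots,n$. -/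

import Mathlib

namespace TorusIntertwiner

noncomputable section

/-! ## The Heisenberg Fock space and its charged sectors -/

/-- The Heisenberg Fock space `M`, realised as the polynomial ring in the creation operators
`a(-1), a(-2), …` applied to the vacuum `1`; the variable `X n` stands for `a(-n)`. -/
abbrev Fock : Type := MvPolynomial ℕ+ ℂ

/-- `𝓜 = ⨁_{μ ∈ ℂ} M ⊗ e^μ`; the vector `u ⊗ e^μ` is `Finsupp.single μ u`. -/
abbrev GenFock : Type := ℂ →₀ Fock

/-- The zero mode `exp (s a(0))`, i.e. `u ⊗ e^μ ↦ e^{s μ} u ⊗ e^μ`. -/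
def expChargeOp (s : ℂ) : Module.End ℂ GenFock :=
  Finsupp.lsum ℂ fun μ : ℂ => Complex.exp (s * μ) • Finsupp.lsingle μ

/-- The shift `e^{β q̂}`, i.e. `u ⊗ e^μ ↦ u ⊗ e^{μ + β}`. -/
def shiftOp (β : ℂ) : Module.End ℂ GenFock :=
  Finsupp.lmapDomain Fock ℂ fun μ : ℂ => μ + β

/-- The Heisenberg modes `a(n)` on `𝓜`: for `n > 0`, `a(-n)` multiplies by `X n` and `a(n)` is
`n ∂/∂X n` in every sector, while `a(0)` acts on `M ⊗ e^μ` as `μ`. Hence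
`[a(m), a(n)] = m δ_{m,-n}`. -/
def heis : ℤ → Module.End ℂ GenFock
  | Int.ofNat 0 => Finsupp.lsum ℂ fun μ : ℂ => μ • Finsupp.lsingle μ
  | Int.ofNat (n + 1) =>
      Finsupp.mapRange.linearMap
        (((n : ℂ) + 1) • (MvPolynomial.pderiv (R := ℂ) n.succPNat).toLinearMap)
  | Int.negSucc n =>
      Finsupp.mapRange.linearMap
        (LinearMap.mulLeft ℂ (MvPolynomial.X n.succPNat : Fock))

/-- The Fock basis vector `a(-1)^{l 1} a(-2)^{l 2} ⋯ 1 ⊗ e^μ`. -/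
def basisVec (μ : ℂ) (l : ℕ+ →₀ ℕ) : GenFock :=
  Finsupp.single μ (MvPolynomial.monomial l 1)

/-- The `L(0)`-weight `∑ n · l n + μ² / 2` of `basisVec μ l`. -/
def weight (μ : ℂ) (l : ℕ+ →₀ ℕ) : ℂ :=
  (l.sum fun n k => ((n : ℕ) : ℂ) * (k : ℂ)) + μ ^ 2 / 2

/-! ## Vertex operators of the highest weight vectors `e^β` -/

/-- The exponential `∑_j A^j / j!` of a formal power series `A` with operator coefficients and
vanishing constant term (then `A^j` has no terms of degree `< j`). -/
def expSeries (A : PowerSeries (Module.End ℂ GenFock)) : PowerSeries (Module.End ℂ GenFock) :=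
  PowerSeries.mk fun k =>
    ∑ j ∈ Finset.range (k + 1), ((j.factorial : ℂ)⁻¹) • PowerSeries.coeff k (A ^ j)

/-- `Y₋(β, z) = exp (β ∑_{n > 0} a(-n) z^n / n)`, a power series in `z`. -/
def Yminus (β : ℂ) : PowerSeries (Module.End ℂ GenFock) :=
  expSeries (PowerSeries.mk fun n : ℕ => if n = 0 then 0 else (β / (n : ℂ)) • heis (-(n : ℤ)))

/-- `Y₊(β, z) = exp (-β ∑_{n > 0} a(n) z^{-n} / n)`, a power series in `z⁻¹`. -/
def Yplus (β : ℂ) : PowerSeries (Module.End ℂ GenFock) :=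
  expSeries (PowerSeries.mk fun n : ℕ => if n = 0 then 0 else (-β / (n : ℂ)) • heis (n : ℤ))

/-- The vertex operator of the vector `e^β = 1 ⊗ e^β` is
`𝒴(e^β, z) = e^{β q̂} Y₋(β, z) Y₊(β, z) z^{β a(0)}`, where complex powers of `z = q_ζ = e^ζ` are
`z^c = e^{c ζ}`. This is the contribution to `𝒴(q_ζ^{L(0)} e^β, q_ζ)` of the `z^k`-term of `Y₋`
and of the `z^{-l}`-term of `Y₊`; here `q_ζ^{L(0)} e^β = e^{ζ β² / 2} e^β`. -/
def vertexTerm (β ζ : ℂ) (k l : ℕ) : Module.End ℂ GenFock :=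
  (Complex.exp (ζ * weight β 0) * Complex.exp (((k : ℂ) - (l : ℂ)) * ζ)) •
    (shiftOp β * PowerSeries.coeff k (Yminus β) * PowerSeries.coeff l (Yplus β) *
      expChargeOp (ζ * β))

/-! ## Torus orbifold intertwining functions -/

/-- The terms of the series defining
`Tr_{V_{ℤ+α}} (e^{2πi β a(0)} 𝒴(q₁^{L(0)} e^{β₁}, q₁) ⋯ 𝒴(q_r^{L(0)} e^{β_r}, q_r) q^{L(0)-1/24})`
with `q = e^{2πiτ}`, `q_i = e^{z_i}`, for the list `ins = [(β₁, z₁), …, (β_r, z_r)]`.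
The indices are: `m`, for the sector `M ⊗ e^μ`, `μ = m + α`; `l`, for the Fock basis vector of that
sector whose diagonal matrix element is taken; and `p`, for the terms of the vertex operators. -/
def traceTerm (α β : ℝ) (τ : UpperHalfPlane) (ins : List (ℂ × ℂ))
    (b : ℤ × (ℕ+ →₀ ℕ) × (Fin ins.length → ℕ × ℕ)) : ℂ :=
  let μ : ℂ := (b.1 : ℂ) + (α : ℂ)
  let A : Module.End ℂ GenFock :=
    expChargeOp (2 * Real.pi * Complex.I * (β : ℂ)) *
      (List.ofFn fun i : Fin ins.length =>
        vertexTerm (ins.get i).1 (ins.get i).2 (b.2.2 i).1 (b.2.2 i).2).prod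
  MvPolynomial.coeff b.2.1 ((A (basisVec μ b.2.1)) μ) *
    Complex.exp (2 * Real.pi * Complex.I * (τ : ℂ) * (weight μ b.2.1 - 1 / 24))

/-- The torus orbifold intertwining function
`Z^{(1)}[f₁; g₁](e^{β₁}, z₁; …; e^{β_r}, z_r; q)`, with `σ f₁ = e^{2πi β a(0)}` and
`σ g₁ = e^{-2πi α a(0)}`. -/
def torusFn (α β : ℝ) (τ : UpperHalfPlane) (ins : List (ℂ × ℂ)) : ℂ :=
  ∑' b, traceTerm α β τ ins b

/-- The insertions `e^κ` at `w` and `e^{-κ}` at `0`. -/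
def basicInsertions (κ : ℝ) (w : ℂ) : List (ℂ × ℂ) :=
  [((κ : ℂ), w), (-(κ : ℂ), 0)]

/-- The insertions `ψ⁺, x₁; ψ⁻, y₁; …; ψ⁺, x_n; ψ⁻, y_n; e^κ, w; e^{-κ}, 0`, where
`ψ^± = e^{±1}`. -/
def generatingInsertions (κ : ℝ) (w : ℂ) {n : ℕ} (x y : Fin n → ℂ) : List (ℂ × ℂ) :=
  (List.ofFn fun i : Fin n => [((1 : ℂ), x i), ((-1 : ℂ), y i)]).flatten ++ basicInsertions κ w

/-- Forms in the commuting symbols `dx_i^{1/2}` and `dy_j^{1/2}`, `i, j = 1, …, n`. -/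
abbrev HalfForm (n : ℕ) : Type := MvPolynomial (Fin n ⊕ Fin n) ℂ

/-- The symbol `dx_i^{1/2}`. -/
def dxHalf {n : ℕ} (i : Fin n) : HalfForm n := MvPolynomial.X (Sum.inl i)

/-- The symbol `dy_j^{1/2}`. -/
def dyHalf {n : ℕ} (j : Fin n) : HalfForm n := MvPolynomial.X (Sum.inr j)

/-- The generating form `𝒢_n^{(1)}[f₁; g₁](x₁, y₁, …, x_n, y_n)`. -/
def generatingForm (α β : ℝ) (τ : UpperHalfPlane) (κ : ℝ) (w : ℂ) {n : ℕ} (x y : Fin n → ℂ) :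
    HalfForm n :=
  MvPolynomial.C (torusFn α β τ (generatingInsertions κ w x y)) *
    ∏ i : Fin n, (dxHalf i * dyHalf i)

/-! ## Theta functions and the Szegő kernel -/

/-- The theta series `ϑ[α; β](z, τ) = ∑_{n ∈ ℤ} exp (iπ (n+α)² τ + (n+α)(z + 2πi β))`. -/
def theta (α β : ℝ) (z : ℂ) (τ : UpperHalfPlane) : ℂ :=
  ∑' n : ℤ, Complex.exp (Real.pi * Complex.I * ((n : ℂ) + (α : ℂ)) ^ 2 * (τ : ℂ) +
    ((n : ℂ) + (α : ℂ)) * (z + 2 * Real.pi * Complex.I * (β : ℂ)))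

/-- `ϑ₁ = ϑ[1/2; 1/2]`. -/
def theta1 (z : ℂ) (τ : UpperHalfPlane) : ℂ := theta (1 / 2) (1 / 2) z τ

/-- The coefficient `K(z, τ) = ϑ₁(z, τ) / ϑ₁'(0, τ)` of the genus one prime form. -/
def primeK (z : ℂ) (τ : UpperHalfPlane) : ℂ :=
  theta1 z τ / deriv (fun u : ℂ => theta1 u τ) 0

/-- `ℓ` is a continuous branch of `log ϑ₁(·, τ)` on the strip `0 < Re z < 2π Im τ`
(i.e. `1 < |e^z| < |q|⁻¹`), on which `ϑ₁` has no zeros. -/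
def IsLogTheta1 (τ : UpperHalfPlane) (ℓ : ℂ → ℂ) : Prop :=
  ContinuousOn ℓ {z : ℂ | 0 < z.re ∧ z.re < 2 * Real.pi * τ.im} ∧
    ∀ z : ℂ, 0 < z.re → z.re < 2 * Real.pi * τ.im → Complex.exp (ℓ z) = theta1 z τ

/-- The coefficient of `dx^{1/2} dy^{1/2}` in the `κ`-twisted Szegő kernel
`(ϑ₁(x-w) ϑ₁(y) / (ϑ₁(x) ϑ₁(y-w)))^κ ϑ[α; β](x-y+κw) / (ϑ[α; β](κw) K(x-y))`. The power is taken
with the branch `ℓ` of `log ϑ₁`; adding a constant to `ℓ` does not change it. -/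
def szego (ℓ : ℂ → ℂ) (α β : ℝ) (τ : UpperHalfPlane) (κ : ℝ) (w x y : ℂ) : ℂ :=
  Complex.exp ((κ : ℂ) * (ℓ (x - w) + ℓ y - ℓ x - ℓ (y - w))) *
    (theta α β (x - y + (κ : ℂ) * w) τ /
      (theta α β ((κ : ℂ) * w) τ * primeK (x - y) τ))

/-- The `n × n` matrix `S_κ = (S_κ(x_i, y_j))`. -/
def szegoMatrix (ℓ : ℂ → ℂ) (α β : ℝ) (τ : UpperHalfPlane) (κ : ℝ) (w : ℂ) {n : ℕ}
    (x y : Fin n → ℂ) : Matrix (Fin n) (Fin n) (HalfForm n) :=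
  Matrix.of fun i j =>
    MvPolynomial.C (szego ℓ α β τ κ w (x i) (y j)) * (dxHalf i * dyHalf j)

end

end TorusIntertwiner

/-!
The trace is computed exactly. On the monomial basis of the Fock space a term of a vertex operator
is a sum of products over the modes `n ≥ 1` of `(b^k / k!) X^k ∘ (c^j / j!) ∂^j`, where `X = a(-n)`
and `∂ = a(n) / n` (`vertexTerm_basisVec`). The trace therefore splits into the theta series coming
from the zero modes and an Euler product of one-mode traces (`summable_and_tendsto_finsupp_prod`,
`fockDiag_occupationEquiv`). The one-mode trace of `∏ exp (b X) exp (c ∂)` with `Q^N` equals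
`(1 - Q)⁻¹` times the exponential of a quadratic expression in the `b`, `c` (`hasSum_modeDiag`):
applied to `X^l` the product is `K e^{B y} (y + C)^l`, from which the diagonal coefficient is read
off. Absolute convergence comes from the same formula with all coefficients replaced by their
absolute values. Summing the exponents over the modes gives, for total charge zero,

  `Tr = η(τ)⁻¹ ϑ[α; β](∑ β_i z_i) ∏_{i < j} exp (β_i β_j logPrime (z_i - z_j))`

(`hasSum_traceTerm`), where `logPrime` is an explicit series. The Jacobi triple product, obtained as
the limit of its finite form, shows that `logPrime` is a branch of `log K` (`exp_logPrime`), hence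
up to a constant a branch of `log ϑ₁`.

For the insertions of the generating form, the charges `±1` produce
`∏_{i<j} K(x_i - x_j) K(y_j - y_i) / ∏_{i,j} K(x_i - y_j)`, their interactions with `e^{±κ}` produce
the `κ`-th powers of the Szegő kernel, and the theta function has argument
`κ w + ∑ (x_i - y_i)`. What remains is the Frobenius (Fay) determinant formula `frobenius_det` for
`ϑ[α; β](a + x_i - y_j) / K(x_i - y_j)`. It follows by induction over Schur complements from the
three-term relation `theta_primeK_relation`, which is a Plücker relation, because
`ϑ₁(x + y, τ) ϑ₁(x - y, τ)` is an alternating bilinear expression in two theta functions at `2τ`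
(`theta1_add_mul_theta1_sub`).
-/

namespace TorusIntertwiner

open Filter Topology

/-! ### Absolutely convergent multiple series -/

lemma hasSum_mul_prod {𝕜 ι κ : Type*} [RCLike 𝕜] {f : ι → 𝕜} {g : κ → 𝕜} {a b : 𝕜}
    (hf : HasSum f a) (hg : HasSum g b) :
    HasSum (fun x : ι × κ => f x.1 * g x.2) (a * b) := by
  have hs := summable_mul_of_summable_norm hf.summable.norm hg.summable.norm
  have h := tsum_mul_tsum_of_summable_norm hf.summable.norm hg.summable.norm
  rw [hf.tsum_eq, hg.tsum_eq] at h
  rw [h]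
  exact hs.hasSum

/-- An iterated sum is a sum over pairs if the sums of the norms along the fibres are summable. -/
lemma hasSum_prod_of_fibers {α β : Type*} {f : α × β → ℂ} {g : α → ℂ} {N : α → ℝ} {G : ℂ}
    (h₁ : ∀ x, HasSum (fun y => f (x, y)) (g x)) (h₂ : ∀ x, HasSum (fun y => ‖f (x, y)‖) (N x))
    (h₃ : Summable N) (h₄ : HasSum g G) : HasSum f G := by
  have hs : Summable f := by
    refine Summable.of_norm ((summable_prod_of_nonneg fun _ => norm_nonneg _).2
      ⟨fun x => (h₂ x).summable, ?_⟩)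
    exact h₃.congr fun x => (h₂ x).tsum_eq.symm
  have h := hs.hasSum.prod_fiberwise h₁
  rw [← h.unique h₄]
  exact hs.hasSum

/-- Grouping the terms of a series along a map `φ` with finite fibres. -/
lemma hasSum_of_fiber_finset {X P : Type*} {F : X → ℂ} {a : ℂ} (hF : HasSum F a) (φ : X → P)
    (fib : P → Finset X) (hfib : ∀ p x, x ∈ fib p ↔ φ x = p) :
    HasSum (fun p => ∑ x ∈ fib p, F x) a := by
  refine HasSum.sigma ((Equiv.sigmaFiberEquiv φ).hasSum_iff.2 hF) fun p => ?_
  have h := (fib p).hasSum F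
  exact (Equiv.subtypeEquivRight fun x => (hfib p x).symm).hasSum_iff.2 h

/-- Removing the value at `a` identifies the finitely supported functions with support in
`insert a s` with pairs. -/
noncomputable def finsuppInsertEquiv {ι A : Type*} [DecidableEq ι] [Zero A] {a : ι} {s : Finset ι}
    (ha : a ∉ s) :
    A × {f : ι →₀ A // f.support ⊆ s} ≃ {f : ι →₀ A // f.support ⊆ insert a s} where
  toFun x := ⟨x.2.1.update a x.1, by
    classical
    refine (Finsupp.support_update_subset ..).trans ?_
    exact Finset.insert_subset_insert _ x.2.2⟩
  invFun f := (f.1 a, ⟨f.1.erase a, by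
    intro i hi
    rw [Finsupp.support_erase, Finset.mem_erase] at hi
    exact (Finset.mem_insert.1 (f.2 hi.2)).resolve_left hi.1⟩)
  left_inv x := by
    obtain ⟨c, f, hf⟩ := x
    have hfa : f a = 0 := Finsupp.notMem_support_iff.1 fun h => ha (hf h)
    ext i
    · simp
    · by_cases hi : i = a
      · subst hi; simp [hfa]
      · simp [hi]
  right_inv f := by
    ext i
    by_cases hi : i = a
    · subst hi; simp
    · simp

lemma hasSum_prod_support_subset {𝕜 ι A : Type*} [RCLike 𝕜] [Zero A] (g : ι → A → 𝕜)
    (S : ι → 𝕜) (hS : ∀ i, HasSum (g i) (S i)) (s : Finset ι) :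
    HasSum (fun f : {f : ι →₀ A // f.support ⊆ s} => ∏ i ∈ s, g i (f.1 i)) (∏ i ∈ s, S i) := by
  classical
  induction s using Finset.induction_on with
  | empty =>
    have : Unique {f : ι →₀ A // f.support ⊆ (∅ : Finset ι)} :=
      { default := ⟨0, by simp⟩
        uniq := fun f => Subtype.ext (Finsupp.support_eq_empty.1 (Finset.subset_empty.1 f.2)) }
    simp
  | insert a s ha ih =>
    rw [Finset.prod_insert ha]
    refine (finsuppInsertEquiv ha).hasSum_iff.1 ?_
    convert hasSum_mul_prod (hS a) ih using 2 with x
    rw [Function.comp_apply, Finset.prod_insert ha]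
    congr 1
    · simp [finsuppInsertEquiv]
    · refine Finset.prod_congr rfl fun i hi => ?_
      have : i ≠ a := fun h => ha (h ▸ hi)
      simp [finsuppInsertEquiv, this]

/-- A series over finitely supported functions whose terms are products of local factors is the
limit of the finite products of the local series (an Euler product). -/
theorem summable_and_tendsto_finsupp_prod {ι A : Type*} [Zero A] (g : ι → A → ℂ) (S : ι → ℂ)
    (N : ι → ℝ) (h0 : ∀ i, g i 0 = 1) (hS : ∀ i, HasSum (g i) (S i))
    (hN : ∀ i, HasSum (fun a => ‖g i a‖) (N i)) (C : ℝ) (hC : ∀ s : Finset ι, ∏ i ∈ s, N i ≤ C) :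
    Summable (fun f : ι →₀ A => f.prod g) ∧
      Tendsto (fun s : Finset ι => ∏ i ∈ s, S i) atTop (𝓝 (∑' f : ι →₀ A, f.prod g)) := by
  classical
  have key : ∀ (s : Finset ι) (f : ι →₀ A), f.support ⊆ s → f.prod g = ∏ i ∈ s, g i (f i) :=
    fun s f hf => Finsupp.prod_of_support_subset f hf g fun i _ => h0 i
  have hsum : Summable (fun f : ι →₀ A => f.prod g) := by
    refine Summable.of_norm (summable_of_sum_le (c := C) (fun _ => norm_nonneg _) fun u => ?_)
    set s := u.biUnion Finsupp.support
    have hu : ∀ f ∈ u, f.support ⊆ s := fun f hf => Finset.subset_biUnion_of_mem _ hf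
    have h := hasSum_prod_support_subset (fun i a => ‖g i a‖) N hN s
    calc ∑ f ∈ u, ‖f.prod g‖ = ∑ f ∈ u.subtype (fun f => f.support ⊆ s), ‖f.1.prod g‖ := by
          rw [Finset.sum_subtype_of_mem (fun f => ‖f.prod g‖) hu]
      _ = ∑ f ∈ u.subtype (fun f => f.support ⊆ s), ∏ i ∈ s, ‖g i (f.1 i)‖ := by
          refine Finset.sum_congr rfl fun f _ => ?_
          rw [key s f.1 f.2, norm_prod]
      _ ≤ ∏ i ∈ s, N i :=
          sum_le_hasSum _ (fun _ _ => Finset.prod_nonneg fun _ _ => norm_nonneg _) h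
      _ ≤ C := hC s
  refine ⟨hsum, ?_⟩
  have h1 : ∀ s : Finset ι, ∏ i ∈ s, S i =
      ∑' f : ι →₀ A, Set.indicator {f : ι →₀ A | f.support ⊆ s} (fun f => f.prod g) f := by
    intro s
    rw [← tsum_subtype, ← (hasSum_prod_support_subset g S hS s).tsum_eq]
    exact tsum_congr fun f => (key s f.1 f.2).symm
  simp_rw [h1]
  refine tendsto_tsum_of_dominated_convergence hsum.norm (fun f => ?_)
    (Eventually.of_forall fun s f => ?_)
  · refine tendsto_const_nhds.congr' ?_
    filter_upwards [eventually_ge_atTop f.support] with s hs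
    rw [Set.indicator_of_mem]
    exact hs
  · exact norm_indicator_le_norm_self _ _

lemma eq_of_hasSum_mul_pow {a b : ℕ → ℂ} {F : ℂ → ℂ}
    (ha : ∀ y, HasSum (fun n => a n * y ^ n) (F y))
    (hb : ∀ y, HasSum (fun n => b n * y ^ n) (F y)) : a = b := by
  have h : ∀ c : ℕ → ℂ, (∀ y, HasSum (fun n => c n * y ^ n) (F y)) →
      HasFPowerSeriesAt F (FormalMultilinearSeries.ofScalars ℂ c) 0 := by
    intro c hc
    rw [hasFPowerSeriesAt_iff]
    refine Eventually.of_forall fun y => ?_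
    simpa [FormalMultilinearSeries.coeff_ofScalars, mul_comm] using hc y
  have := (h a ha).eq_formalMultilinearSeries (h b hb)
  funext n
  have h2 := congrArg (fun p => FormalMultilinearSeries.coeff p n) this
  simpa [FormalMultilinearSeries.coeff_ofScalars] using h2

/-! ### The trace of a product of exponentials over the Fock space of one mode -/

section Mode

variable {α : Type*}

/-- The sum of `f a a'` over all pairs `a`, `a'` of entries of a list with `a` before `a'`. -/
def pairSum (f : α → α → ℂ) : List α → ℂ
  | [] => 0
  | a :: L => (L.map (f a)).sum + pairSum f L

/-- The exponent of `X` after `X^N` has been hit, for the entries of `L` from right to left, by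
`∂^j` and then by multiplication with `X^k`, where `(k, j)` is the entry of `p`. -/
def modeOut : (L : List α) → (Fin L.length → ℕ × ℕ) → ℕ → ℕ
  | [], _, N => N
  | _ :: L, p, N => modeOut L (Fin.tail p) N - (p 0).2 + (p 0).1

/-- The product of the operators `(b^k / k!) X^k ∘ (c^j / j!) ∂^j`, for the entries of `L` from
right to left, maps `X^N` to `modeAmp b c L p N` times `X ^ modeOut L p N`. -/
noncomputable def modeAmp (b c : α → ℂ) : (L : List α) → (Fin L.length → ℕ × ℕ) → ℕ → ℂ
  | [], _, _ => 1
  | a :: L, p, N =>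
      (b a ^ (p 0).1 / ((p 0).1.factorial : ℂ) *
        (c a ^ (p 0).2 * ((modeOut L (Fin.tail p) N).choose (p 0).2 : ℂ))) *
      modeAmp b c L (Fin.tail p) N

/-- The exponent of the one-mode trace: contractions between different operators, and
contractions around the trace. -/
noncomputable def modeExponent (b c : α → ℂ) (L : List α) (Q : ℂ) : ℂ :=
  pairSum (fun a a' => c a * b a') L + (L.map b).sum * (L.map c).sum * Q / (1 - Q)

/-- The diagonal matrix elements whose sum is the one-mode trace. -/
noncomputable def modeDiag (b c : α → ℂ) (L : List α) (Q : ℂ)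
    (x : ℕ × (Fin L.length → ℕ × ℕ)) : ℂ :=
  if modeOut L x.2 x.1 = x.1 then modeAmp b c L x.2 x.1 * Q ^ x.1 else 0

lemma hasSum_antidiagonal {f : ℕ × ℕ → ℂ} {a : ℂ} (h : HasSum f a) :
    HasSum (fun n => ∑ x ∈ Finset.HasAntidiagonal.antidiagonal n, f x) a :=
  hasSum_of_fiber_finset h (fun x => x.1 + x.2) _ fun p x => by simp

lemma hasSum_exp_series (z : ℂ) :
    HasSum (fun n : ℕ => z ^ n / (n.factorial : ℂ)) (Complex.exp z) := by
  rw [Complex.exp_eq_exp_ℂ]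
  exact NormedSpace.expSeries_div_hasSum_exp z

lemma hasSum_binomial (c y : ℂ) (N : ℕ) :
    HasSum (fun j : ℕ => c ^ j * (N.choose j : ℂ) * y ^ (N - j)) ((y + c) ^ N) := by
  rw [add_comm y c, add_pow]
  have : ∑ m ∈ Finset.range (N + 1), c ^ m * y ^ (N - m) * (N.choose m : ℂ) =
      ∑ m ∈ Finset.range (N + 1), c ^ m * (N.choose m : ℂ) * y ^ (N - m) :=
    Finset.sum_congr rfl fun m _ => by ring
  rw [this]
  refine hasSum_sum_of_ne_finset_zero fun j hj => ?_
  rw [Nat.choose_eq_zero_of_lt (by simpa using hj)]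
  simp

lemma hasSum_norm_of_ofReal {ι : Type*} {f : ι → ℂ} {a : ℝ}
    (h : HasSum (fun i => ((‖f i‖ : ℝ) : ℂ)) (a : ℂ)) : HasSum (fun i => ‖f i‖) a :=
  Complex.hasSum_ofReal.1 h

/-- On entire functions `exp (b X)` multiplies and `exp (c ∂)` translates by `c`, so the product of
the operators `exp (b X) exp (c ∂)` is known on `X^l`. -/
lemma hasSum_modeAmp_mul_pow (b c : α → ℂ) (L : List α) (y : ℂ) (l : ℕ) :
    HasSum (fun p => modeAmp b c L p l * y ^ modeOut L p l)
      (Complex.exp (pairSum (fun a a' => c a * b a') L) * Complex.exp ((L.map b).sum * y) *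
        (y + (L.map c).sum) ^ l) := by
  induction L generalizing y with
  | nil =>
    have : Unique (Fin ([] : List α).length → ℕ × ℕ) := inferInstanceAs (Unique (Fin 0 → ℕ × ℕ))
    convert! hasSum_unique (fun p : Fin ([] : List α).length → ℕ × ℕ =>
      modeAmp b c [] p l * y ^ modeOut [] p l) using 1
    simp [modeAmp, modeOut, pairSum]
  | cons a L ih =>
    let e : (Fin L.length → ℕ × ℕ) × (ℕ × ℕ) ≃ (Fin (a :: L).length → ℕ × ℕ) :=
      (Equiv.prodComm _ _).trans (Fin.consEquiv fun _ : Fin (L.length + 1) => ℕ × ℕ)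
    refine e.hasSum_iff.1 ?_
    have hterm : ∀ (p : Fin L.length → ℕ × ℕ) (k j : ℕ),
        modeAmp b c (a :: L) (e (p, (k, j))) l * y ^ modeOut (a :: L) (e (p, (k, j))) l =
        modeAmp b c L p l * ((b a * y) ^ k / (k.factorial : ℂ) *
          (c a ^ j * ((modeOut L p l).choose j : ℂ) * y ^ (modeOut L p l - j))) := by
      intro p k j
      have h1 : Fin.tail (e (p, (k, j))) = p := rfl
      have h2 : e (p, (k, j)) 0 = (k, j) := rfl
      simp only [modeAmp, modeOut, h1, h2, pow_add, mul_pow]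
      ring
    have hfib : ∀ N : ℕ, HasSum (fun x : ℕ × ℕ => (b a * y) ^ x.1 / (x.1.factorial : ℂ) *
        (c a ^ x.2 * (N.choose x.2 : ℂ) * y ^ (N - x.2)))
        (Complex.exp (b a * y) * (y + c a) ^ N) := by
      intro N
      have h := hasSum_mul_prod (hasSum_exp_series (b a * y)) (hasSum_binomial (c a) y N)
      exact h
    have hfibn : ∀ N : ℕ, HasSum (fun x : ℕ × ℕ => ‖(b a * y) ^ x.1 / (x.1.factorial : ℂ) *
        (c a ^ x.2 * (N.choose x.2 : ℂ) * y ^ (N - x.2))‖)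
        (Real.exp ‖b a * y‖ * (‖y‖ + ‖c a‖) ^ N) := by
      intro N
      refine hasSum_norm_of_ofReal ?_
      have := hasSum_mul_prod (hasSum_exp_series ((‖b a * y‖ : ℝ) : ℂ))
        (hasSum_binomial ((‖c a‖ : ℝ) : ℂ) ((‖y‖ : ℝ) : ℂ) N)
      push_cast at this ⊢
      convert! this using 2 with x
      simp
    refine hasSum_prod_of_fibers
      (g := fun p => modeAmp b c L p l * (Complex.exp (b a * y) * (y + c a) ^ modeOut L p l))
      (N := fun p => ‖modeAmp b c L p l‖ *
        (Real.exp ‖b a * y‖ * (‖y‖ + ‖c a‖) ^ modeOut L p l)) ?_ ?_ ?_ ?_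
    · intro p
      simp only [Function.comp_apply, hterm]
      exact (hfib (modeOut L p l)).mul_left _
    · intro p
      simp only [Function.comp_apply, hterm, norm_mul (modeAmp b c L p l)]
      exact (hfibn (modeOut L p l)).mul_left _
    · have h := ((ih ((‖y‖ + ‖c a‖ : ℝ) : ℂ)).summable.norm).mul_left (Real.exp ‖b a * y‖)
      refine h.congr fun p => ?_
      rw [norm_mul (modeAmp b c L p l), norm_pow, Complex.norm_real,
        Real.norm_of_nonneg (by positivity)]
      ring
    · have h := (ih (y + c a)).mul_left (Complex.exp (b a * y))
      convert! h using 1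
      · funext p; ring
      · simp only [pairSum, List.map_cons, List.sum_cons, List.sum_map_mul_left, Complex.exp_add,
          add_mul, mul_add]
        rw [show y + c a + (L.map c).sum = y + (c a + (L.map c).sum) by ring,
          mul_comm (c a) (L.map b).sum]
        ring

/-- The diagonal matrix elements at `X^l`, summed over the expansions of all operators. -/
lemma hasSum_modeAmp_out_eq (b c : α → ℂ) (L : List α) (l : ℕ) :
    HasSum (fun p => if modeOut L p l = l then modeAmp b c L p l else 0)
      (Complex.exp (pairSum (fun a a' => c a * b a') L) *
        ∑ x ∈ Finset.HasAntidiagonal.antidiagonal l,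
          ((L.map b).sum * (L.map c).sum) ^ x.1 / (x.1.factorial : ℂ) *
            ((x.1 + x.2).choose x.1 : ℂ)) := by
  set K := Complex.exp (pairSum (fun a a' => c a * b a') L)
  set B := (L.map b).sum
  set C := (L.map c).sum
  have hone : Summable (fun p => modeAmp b c L p l) := by
    simpa using (hasSum_modeAmp_mul_pow b c L 1 l).summable
  -- Both sides are the `l`-th Taylor coefficient of `K exp (B y) (y + C)^l`.
  have h1 : ∀ y : ℂ, HasSum
      (fun n => (∑' p : {p // modeOut L p l = n}, modeAmp b c L p.1 l) * y ^ n)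
      (K * Complex.exp (B * y) * (y + C) ^ l) := by
    intro y
    refine HasSum.sigma ((Equiv.sigmaFiberEquiv fun p => modeOut L p l).hasSum_iff.2
      (hasSum_modeAmp_mul_pow b c L y l)) fun n => ?_
    have h := (hone.subtype {p | modeOut L p l = n}).hasSum.mul_right (y ^ n)
    refine h.congr_fun fun p => ?_
    have hp : modeOut L p.1 l = n := p.2
    simp [Equiv.sigmaFiberEquiv, hp]
  have h2 : ∀ y : ℂ, HasSum (fun n => (K * ∑ x ∈ Finset.HasAntidiagonal.antidiagonal n,
      B ^ x.1 / (x.1.factorial : ℂ) * ((l.choose x.2 : ℂ) * C ^ (l - x.2))) * y ^ n)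
      (K * Complex.exp (B * y) * (y + C) ^ l) := by
    intro y
    have h := (hasSum_antidiagonal (hasSum_mul_prod (hasSum_exp_series (B * y))
      (hasSum_binomial y C l))).mul_left K
    rw [mul_assoc, add_comm y C]
    convert! h using 2 with n
    rw [mul_assoc, Finset.sum_mul]
    congr 1
    refine Finset.sum_congr rfl fun x hx => ?_
    rw [← Finset.HasAntidiagonal.mem_antidiagonal.1 hx, mul_pow, pow_add]
    ring
  have h3 := congrFun (eq_of_hasSum_mul_pow h1 h2) l
  have h4 : ∑ x ∈ Finset.HasAntidiagonal.antidiagonal l, (B * C) ^ x.1 / (x.1.factorial : ℂ) *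
      ((x.1 + x.2).choose x.1 : ℂ) = ∑ x ∈ Finset.HasAntidiagonal.antidiagonal l,
      B ^ x.1 / (x.1.factorial : ℂ) * ((l.choose x.2 : ℂ) * C ^ (l - x.2)) := by
    refine Finset.sum_congr rfl fun x hx => ?_
    have hl := Finset.HasAntidiagonal.mem_antidiagonal.1 hx
    have : l - x.2 = x.1 := by omega
    rw [this, hl, mul_pow, ← hl, Nat.choose_symm_add]
    ring
  rw [h4, ← h3]
  have h5 := (hasSum_subtype_iff_indicator (f := fun p => modeAmp b c L p l)
    (s := {p | modeOut L p l = l})).1 (hone.subtype {p | modeOut L p l = l}).hasSum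
  refine h5.congr_fun fun p => ?_
  simp [Set.indicator_apply]

lemma norm_modeAmp (b c : α → ℂ) (L : List α) (p : Fin L.length → ℕ × ℕ) (N : ℕ) :
    ((‖modeAmp b c L p N‖ : ℝ) : ℂ) =
      modeAmp (fun a => ((‖b a‖ : ℝ) : ℂ)) (fun a => ((‖c a‖ : ℝ) : ℂ)) L p N := by
  induction L with
  | nil => simp [modeAmp]
  | cons a L ih => simp [modeAmp, ← ih]

lemma norm_modeDiag (b c : α → ℂ) (L : List α) (Q : ℂ) (x : ℕ × (Fin L.length → ℕ × ℕ)) :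
    ((‖modeDiag b c L Q x‖ : ℝ) : ℂ) =
      modeDiag (fun a => ((‖b a‖ : ℝ) : ℂ)) (fun a => ((‖c a‖ : ℝ) : ℂ)) L ((‖Q‖ : ℝ) : ℂ) x := by
  unfold modeDiag
  split_ifs
  · simp [← norm_modeAmp]
  · simp

/-- The trace over the polynomial ring in one variable of a product of operators
`exp (b X) exp (c ∂)` with the grading operator `Q^N`. -/
theorem hasSum_modeDiag (b c : α → ℂ) (L : List α) {Q : ℂ} (hQ : ‖Q‖ < 1) :
    HasSum (modeDiag b c L Q) ((1 - Q)⁻¹ * Complex.exp (modeExponent b c L Q)) := by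
  have hfib : ∀ (b c : α → ℂ) (Q : ℂ) (l : ℕ), HasSum (fun p => modeDiag b c L Q (l, p))
      (Complex.exp (pairSum (fun a a' => c a * b a') L) *
        (∑ x ∈ Finset.HasAntidiagonal.antidiagonal l,
        ((L.map b).sum * (L.map c).sum) ^ x.1 / (x.1.factorial : ℂ) *
          ((x.1 + x.2).choose x.1 : ℂ)) * Q ^ l) := by
    intro b c Q l
    convert! (hasSum_modeAmp_out_eq b c L l).mul_right (Q ^ l) using 2 with p
    simp [modeDiag]
  have hsum : ∀ (b c : α → ℂ) (Q : ℂ), ‖Q‖ < 1 → HasSum (fun l =>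
      Complex.exp (pairSum (fun a a' => c a * b a') L) *
        (∑ x ∈ Finset.HasAntidiagonal.antidiagonal l,
        ((L.map b).sum * (L.map c).sum) ^ x.1 / (x.1.factorial : ℂ) *
          ((x.1 + x.2).choose x.1 : ℂ)) * Q ^ l)
      ((1 - Q)⁻¹ * Complex.exp (modeExponent b c L Q)) := by
    intro b c Q hQ
    have hgeo : ∀ {Q : ℂ}, ‖Q‖ < 1 → ∀ (D : ℂ) (i : ℕ),
        HasSum (fun d : ℕ => D ^ i / (i.factorial : ℂ) *
          ((i + d).choose i : ℂ) * Q ^ (i + d))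
        ((1 - Q)⁻¹ * ((D * Q / (1 - Q)) ^ i / (i.factorial : ℂ))) := by
      intro Q hQ D i
      have h := (hasSum_choose_mul_geometric_of_norm_lt_one i hQ).mul_left
        (D ^ i / (i.factorial : ℂ) * Q ^ i)
      convert! h using 1
      · funext d
        rw [pow_add, add_comm d i]
        ring
      · rw [div_pow, mul_pow, pow_succ]
        have : 1 - Q ≠ 0 := by
          intro h0
          rw [← sub_eq_zero.1 h0] at hQ
          simp at hQ
        field_simp
    have hdouble : HasSum (fun x : ℕ × ℕ =>
        ((L.map b).sum * (L.map c).sum) ^ x.1 / (x.1.factorial : ℂ) *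
          ((x.1 + x.2).choose x.1 : ℂ) * Q ^ (x.1 + x.2))
        ((1 - Q)⁻¹ * Complex.exp ((L.map b).sum * (L.map c).sum * Q / (1 - Q))) := by
      refine hasSum_prod_of_fibers (N := fun i => (1 - ‖Q‖)⁻¹ *
          ((‖(L.map b).sum * (L.map c).sum‖ * ‖Q‖ / (1 - ‖Q‖)) ^ i / (i.factorial : ℝ)))
        (hgeo hQ _) (fun i => ?_) ?_ ((hasSum_exp_series _).mul_left _)
      · have hQ' : ‖((‖Q‖ : ℝ) : ℂ)‖ < 1 := by simpa using hQ
        have h := hgeo hQ' ((‖(L.map b).sum * (L.map c).sum‖ : ℝ) : ℂ) i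
        refine hasSum_norm_of_ofReal ?_
        push_cast at h ⊢
        convert! h using 2 with d
        simp
      · exact (Real.summable_pow_div_factorial _).mul_left _
    have h := (hasSum_antidiagonal hdouble).mul_left
      (Complex.exp (pairSum (fun a a' => c a * b a') L))
    convert! h using 1
    · funext l
      rw [mul_assoc, Finset.sum_mul]
      congr 1
      refine Finset.sum_congr rfl fun x hx => ?_
      rw [Finset.HasAntidiagonal.mem_antidiagonal.1 hx]
    · rw [modeExponent, Complex.exp_add]
      ring
  refine hasSum_prod_of_fibers (hfib b c Q) (fun l => (hfib b c Q l).summable.norm.hasSum) ?_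
    (hsum b c Q hQ)
  have hQ' : ‖((‖Q‖ : ℝ) : ℂ)‖ < 1 := by simpa using hQ
  refine Complex.summable_ofReal.1 ((hsum (fun a => ((‖b a‖ : ℝ) : ℂ))
    (fun a => ((‖c a‖ : ℝ) : ℂ)) ((‖Q‖ : ℝ) : ℂ) hQ').summable.congr fun l => ?_)
  rw [Complex.ofReal_tsum, ← (hfib _ _ _ l).tsum_eq]
  exact tsum_congr fun p => (norm_modeDiag b c L Q (l, p)).symm

end Mode

/-! ### Exponential series of commuting operators as sums of divided powers -/

section ExpSeries

/-- The derivation `t d/dt` on power series with coefficients in a semiring `R`. -/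
noncomputable def eulerDeriv {R : Type*} [Semiring R] (f : PowerSeries R) : PowerSeries R :=
  PowerSeries.mk fun k => k • PowerSeries.coeff k f

lemma eulerDeriv_mul {R : Type*} [Semiring R] (f g : PowerSeries R) :
    eulerDeriv (f * g) = eulerDeriv f * g + f * eulerDeriv g := by
  ext k
  simp only [eulerDeriv, PowerSeries.coeff_mk, map_add, PowerSeries.coeff_mul, Finset.smul_sum,
    ← Finset.sum_add_distrib]
  refine Finset.sum_congr rfl fun x hx => ?_
  rw [← Finset.HasAntidiagonal.mem_antidiagonal.1 hx, add_smul, smul_mul_assoc, mul_smul_comm]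

lemma commute_eulerDeriv {R : Type*} [Semiring R] {f : PowerSeries R}
    (hf : ∀ i j, Commute (PowerSeries.coeff i f) (PowerSeries.coeff j f)) :
    Commute f (eulerDeriv f) := by
  ext k
  simp only [eulerDeriv, PowerSeries.coeff_mk, PowerSeries.coeff_mul]
  refine Finset.sum_equiv (Equiv.prodComm ℕ ℕ) (fun x => by simp [add_comm]) fun x _ => ?_
  simp only [Equiv.prodComm_apply, Prod.fst_swap, Prod.snd_swap]
  rw [smul_mul_assoc, mul_smul_comm, (hf x.1 x.2).eq]

lemma eulerDeriv_pow_succ {R : Type*} [Semiring R] {f : PowerSeries R}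
    (hf : ∀ i j, Commute (PowerSeries.coeff i f) (PowerSeries.coeff j f)) (j : ℕ) :
    eulerDeriv (f ^ (j + 1)) = (j + 1) • (eulerDeriv f * f ^ j) := by
  induction j with
  | zero => simp
  | succ j ih =>
    rw [pow_succ', eulerDeriv_mul, ih, mul_smul_comm, ← mul_assoc, (commute_eulerDeriv hf).eq,
      mul_assoc, ← pow_succ', ← succ_nsmul']

lemma coeff_pow_eq_zero_of_lt {R : Type*} [Semiring R] {f : PowerSeries R}
    (hf : PowerSeries.coeff 0 f = 0) {j k : ℕ} (h : k < j) : PowerSeries.coeff k (f ^ j) = 0 := by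
  induction j generalizing k with
  | zero => omega
  | succ j ih =>
    rw [pow_succ', PowerSeries.coeff_mul]
    refine Finset.sum_eq_zero fun x hx => ?_
    have hx' := Finset.HasAntidiagonal.mem_antidiagonal.1 hx
    rcases Nat.eq_zero_or_pos x.1 with h0 | h0
    · rw [h0, hf, zero_mul]
    · rw [ih (by omega), mul_zero]

/-- The coefficient of `t^k` in `∑_j A^j / j!`, for a power series `A` without constant term. -/
noncomputable def expCoeff {R : Type*} [Semiring R] [Algebra ℂ R] (A : PowerSeries R) (k : ℕ) : R :=
  ∑ j ∈ Finset.range (k + 1), ((j.factorial : ℂ)⁻¹) • PowerSeries.coeff k (A ^ j)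

lemma expCoeff_eq_sum {R : Type*} [Semiring R] [Algebra ℂ R] {A : PowerSeries R}
    (hA : PowerSeries.coeff 0 A = 0) {k N : ℕ} (h : k ≤ N) :
    expCoeff A k =
      ∑ j ∈ Finset.range (N + 1), ((j.factorial : ℂ)⁻¹) • PowerSeries.coeff k (A ^ j) := by
  refine Finset.sum_subset (Finset.range_subset_range.2 (by omega)) fun j _ hj => ?_
  have hj' : k < j := by
    by_contra hjk
    exact hj (Finset.mem_range.2 (by omega))
  rw [coeff_pow_eq_zero_of_lt hA hj', smul_zero]

lemma nsmul_expCoeff {R : Type*} [Semiring R] [Algebra ℂ R] {A : PowerSeries R}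
    (hA : PowerSeries.coeff 0 A = 0)
    (hc : ∀ i j, Commute (PowerSeries.coeff i A) (PowerSeries.coeff j A)) (k : ℕ) :
    k • expCoeff A k = ∑ x ∈ Finset.HasAntidiagonal.antidiagonal k,
      (x.1 • PowerSeries.coeff x.1 A) * expCoeff A x.2 := by
  have h1 : ∀ j, k • ((((j + 1).factorial : ℂ)⁻¹) • PowerSeries.coeff k (A ^ (j + 1))) =
      ((j.factorial : ℂ)⁻¹) • PowerSeries.coeff k (eulerDeriv A * A ^ j) := by
    intro j
    have h := congrArg (PowerSeries.coeff k) (eulerDeriv_pow_succ hc j)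
    rw [eulerDeriv, PowerSeries.coeff_mk, map_nsmul] at h
    rw [smul_comm, h, ← Nat.cast_smul_eq_nsmul ℂ (j + 1), smul_smul, Nat.factorial_succ]
    congr 1
    have : ((j : ℂ) + 1) ≠ 0 := Nat.cast_add_one_ne_zero j
    have : (j.factorial : ℂ) ≠ 0 := Nat.cast_ne_zero.2 j.factorial_ne_zero
    push_cast
    field_simp
  have h2 : k • (((Nat.factorial 0 : ℂ)⁻¹) • PowerSeries.coeff k (A ^ 0)) = 0 := by
    rcases Nat.eq_zero_or_pos k with h0 | h0
    · rw [h0, zero_smul]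
    · rw [pow_zero, PowerSeries.coeff_one, if_neg h0.ne', smul_zero, smul_zero]
  have h3 : ∀ x ∈ Finset.HasAntidiagonal.antidiagonal k,
      (x.1 • PowerSeries.coeff x.1 A) * expCoeff A x.2 =
      ∑ j ∈ Finset.range (k + 1), ((j.factorial : ℂ)⁻¹) •
        (PowerSeries.coeff x.1 (eulerDeriv A) * PowerSeries.coeff x.2 (A ^ j)) := by
    intro x hx
    have hx' := Finset.HasAntidiagonal.mem_antidiagonal.1 hx
    rw [expCoeff_eq_sum hA (show x.2 ≤ k by omega), Finset.mul_sum]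
    refine Finset.sum_congr rfl fun j _ => ?_
    rw [mul_smul_comm, eulerDeriv, PowerSeries.coeff_mk]
  rw [expCoeff_eq_sum hA (Nat.le_succ k), Finset.sum_range_succ', smul_add, Finset.smul_sum, h2,
    add_zero, Finset.sum_congr rfl fun j _ => h1 j, Finset.sum_congr rfl h3, Finset.sum_comm]
  refine Finset.sum_congr rfl fun j _ => ?_
  rw [PowerSeries.coeff_mul, Finset.smul_sum]

/-- The degree `∑ n · λ n` of a multi-index, i.e. the `L(0)`-weight of `∏ a(-n)^{λ n}`. -/
def multiDeg (l : ℕ+ →₀ ℕ) : ℕ := l.sum fun n k => (n : ℕ) * k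

lemma multiDeg_add (l m : ℕ+ →₀ ℕ) : multiDeg (l + m) = multiDeg l + multiDeg m :=
  Finsupp.sum_add_index' (fun _ => by simp) fun _ _ _ => by ring

lemma multiDeg_single (n : ℕ+) (k : ℕ) : multiDeg (Finsupp.single n k) = n * k := by
  simp [multiDeg]

lemma mul_le_multiDeg (l : ℕ+ →₀ ℕ) (n : ℕ+) : (n : ℕ) * l n ≤ multiDeg l := by
  by_cases h : n ∈ l.support
  · exact Finset.single_le_sum (f := fun n : ℕ+ => (n : ℕ) * l n) (fun _ _ => Nat.zero_le _) h
  · simp [Finsupp.notMem_support_iff.1 h]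

/-- The positive integers at most `k`. -/
def posUpTo (k : ℕ) : Finset ℕ+ :=
  (Finset.range k).map ⟨Nat.succPNat, Nat.succPNat_injective⟩

lemma support_subset_posUpTo {l : ℕ+ →₀ ℕ} {k : ℕ} (h : multiDeg l ≤ k) :
    l.support ⊆ posUpTo k := by
  intro n hn
  have h1 := mul_le_multiDeg l n
  have h2 : 0 < l n := Nat.pos_of_ne_zero (Finsupp.mem_support_iff.1 hn)
  have h3 : (n : ℕ) ≤ n * l n := Nat.le_mul_of_pos_right _ h2
  refine Finset.mem_map.2 ⟨n.natPred, Finset.mem_range.2 ?_, n.succPNat_natPred⟩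
  have := n.natPred_add_one
  omega

lemma sum_range_mul_eq_multiDeg {l : ℕ+ →₀ ℕ} {k : ℕ} (h : multiDeg l ≤ k) :
    ∑ m ∈ Finset.range k, (m + 1) * l m.succPNat = multiDeg l := by
  rw [multiDeg, Finsupp.sum_of_support_subset l (support_subset_posUpTo h) _ fun _ _ => by simp,
    posUpTo, Finset.sum_map]
  rfl

/-- The multi-indices of degree `k`. -/
noncomputable def multiIdx (k : ℕ) : Finset (ℕ+ →₀ ℕ) :=
  ((posUpTo k).finsupp fun _ => Finset.range (k + 1)).filter fun l => multiDeg l = k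

lemma mem_multiIdx {k : ℕ} {l : ℕ+ →₀ ℕ} : l ∈ multiIdx k ↔ multiDeg l = k := by
  refine ⟨fun h => (Finset.mem_filter.1 h).2, fun h => Finset.mem_filter.2 ⟨?_, h⟩⟩
  refine Finset.mem_finsupp_iff.2 ⟨support_subset_posUpTo h.le, fun n _ => ?_⟩
  have h1 := mul_le_multiDeg l n
  have h2 : l n ≤ n * l n := Nat.le_mul_of_pos_left _ n.pos
  exact Finset.mem_range.2 (by omega)

lemma sum_multiIdx_add_single {M : Type*} [AddCommMonoid M] (f : (ℕ+ →₀ ℕ) → M) (n : ℕ+) (j : ℕ)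
    (hf : ∀ m, m n = 0 → f m = 0) :
    ∑ l ∈ multiIdx j, f (l + Finsupp.single n 1) = ∑ m ∈ multiIdx (n + j), f m := by
  classical
  rw [← Finset.sum_image (f := f) (g := fun l => l + Finsupp.single n 1)
    fun a _ b _ h => add_right_cancel h]
  refine Finset.sum_subset ?_ fun m hm hm' => hf m ?_
  · intro m hm
    obtain ⟨l, hl, rfl⟩ := Finset.mem_image.1 hm
    rw [mem_multiIdx] at hl ⊢
    rw [multiDeg_add, multiDeg_single, hl]
    ring
  · by_contra h0
    refine hm' (Finset.mem_image.2 ⟨m - Finsupp.single n 1, ?_, ?_⟩)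
    · have h1 : m - Finsupp.single n 1 + Finsupp.single n 1 = m :=
        tsub_add_cancel_of_le (Finsupp.single_le_iff.2 (Nat.one_le_iff_ne_zero.2 h0))
      have h2 := multiDeg_add (m - Finsupp.single n 1) (Finsupp.single n 1)
      rw [h1, mem_multiIdx.1 hm, multiDeg_single] at h2
      rw [mem_multiIdx]
      omega
    · exact tsub_add_cancel_of_le (Finsupp.single_le_iff.2 (Nat.one_le_iff_ne_zero.2 h0))

/-- If the `U l` are divided powers of commuting operators `A 1, A 2, …`, then the coefficient of
`t^k` in `exp (∑ A n t^n)` is the sum of the `U l` of degree `k`. -/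
theorem expCoeff_eq_sum_multiIdx {R : Type*} [Semiring R] [Algebra ℂ R] {A : PowerSeries R}
    (hA : PowerSeries.coeff 0 A = 0)
    (hc : ∀ i j, Commute (PowerSeries.coeff i A) (PowerSeries.coeff j A))
    (U : (ℕ+ →₀ ℕ) → R) (hU0 : U 0 = 1)
    (hU : ∀ (n : ℕ+) l, PowerSeries.coeff (n : ℕ) A * U l = (l n + 1) • U (l + Finsupp.single n 1))
    (k : ℕ) : expCoeff A k = ∑ l ∈ multiIdx k, U l := by
  induction k using Nat.strong_induction_on with
  | _ k ih =>
  rcases Nat.eq_zero_or_pos k with h0 | h0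
  · subst h0
    have : multiIdx 0 = {0} := by
      ext l
      rw [mem_multiIdx, Finset.mem_singleton]
      refine ⟨fun h => ?_, fun h => by simp [h, multiDeg]⟩
      ext n
      have := mul_le_multiDeg l n
      rw [h, Nat.le_zero, mul_eq_zero] at this
      exact this.resolve_left n.ne_zero
    rw [this, Finset.sum_singleton, hU0, expCoeff]
    simp
  · have hkey : k • expCoeff A k = k • ∑ l ∈ multiIdx k, U l := by
      rw [nsmul_expCoeff hA hc, Finset.Nat.sum_antidiagonal_eq_sum_range_succ_mk,
        Finset.sum_range_succ', zero_smul, zero_mul, add_zero]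
      have h1 : ∀ m ∈ Finset.range k, ((m + 1) • PowerSeries.coeff (m + 1) A) *
          expCoeff A (k - (m + 1)) =
          ∑ l ∈ multiIdx k, ((m + 1) * l m.succPNat) • U l := by
        intro m hm
        have hm := Finset.mem_range.1 hm
        rw [ih _ (by omega), smul_mul_assoc, Finset.mul_sum]
        have h2 := sum_multiIdx_add_single (fun l => l m.succPNat • U l) m.succPNat (k - (m + 1))
          fun l hl => by simp [hl]
        have h3 : ((m.succPNat : ℕ+) : ℕ) + (k - (m + 1)) = k := by
          rw [Nat.succPNat_coe]; omega
        rw [h3] at h2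
        simp_rw [mul_smul]
        rw [← Finset.smul_sum, ← h2]
        congr 1
        refine Finset.sum_congr rfl fun l _ => ?_
        have := hU m.succPNat l
        rw [Nat.succPNat_coe] at this
        rw [this]
        simp
      rw [Finset.sum_congr rfl h1, Finset.sum_comm, Finset.smul_sum]
      refine Finset.sum_congr rfl fun l hl => ?_
      have hl := mem_multiIdx.1 hl
      rw [← Finset.sum_smul, sum_range_mul_eq_multiDeg hl.le, hl]
    rw [← Nat.cast_smul_eq_nsmul ℂ k, ← Nat.cast_smul_eq_nsmul ℂ k] at hkey
    exact smul_right_injective _ (Nat.cast_ne_zero.2 h0.ne' : (k : ℂ) ≠ 0) hkey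

end ExpSeries

/-! ### The vertex operators on the monomial basis -/

section VertexOperators

lemma genFock_end_ext {S T : Module.End ℂ GenFock}
    (h : ∀ μ N, S (basisVec μ N) = T (basisVec μ N)) : S = T := by
  refine Finsupp.lhom_ext' fun μ => ?_
  refine (MvPolynomial.basisMonomials ℕ+ ℂ).ext fun N => ?_
  simpa [basisVec] using h μ N

lemma smul_basisVec (a : ℂ) (μ : ℂ) (N : ℕ+ →₀ ℕ) :
    a • basisVec μ N = Finsupp.single μ (MvPolynomial.monomial N a) := by
  rw [basisVec, Finsupp.smul_single, MvPolynomial.smul_monomial, smul_eq_mul, mul_one]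

lemma heis_neg_basisVec (n : ℕ+) (μ : ℂ) (N : ℕ+ →₀ ℕ) :
    heis (-((n : ℕ) : ℤ)) (basisVec μ N) = basisVec μ (N + Finsupp.single n 1) := by
  obtain ⟨m, rfl⟩ : ∃ m, n = Nat.succPNat m := ⟨n.natPred, n.succPNat_natPred.symm⟩
  change heis (Int.negSucc m) (basisVec μ N) = _
  simp only [heis, basisVec, Finsupp.mapRange.linearMap_apply, Finsupp.mapRange_single,
    LinearMap.mulLeft_apply, MvPolynomial.X, MvPolynomial.monomial_mul, mul_one]
  rw [add_comm]

lemma heis_pos_basisVec (n : ℕ+) (μ : ℂ) (N : ℕ+ →₀ ℕ) :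
    heis ((n : ℕ) : ℤ) (basisVec μ N) =
      (((n : ℕ) : ℂ) * (N n : ℂ)) • basisVec μ (N - Finsupp.single n 1) := by
  obtain ⟨m, rfl⟩ : ∃ m, n = Nat.succPNat m := ⟨n.natPred, n.succPNat_natPred.symm⟩
  change heis (Int.ofNat (m + 1)) (basisVec μ N) = _
  rw [smul_basisVec]
  simp only [heis, basisVec, Finsupp.mapRange.linearMap_apply, Finsupp.mapRange_single,
    LinearMap.smul_apply, Derivation.coeFn_coe, MvPolynomial.pderiv_monomial,
    MvPolynomial.smul_monomial, smul_eq_mul, one_mul, Nat.succPNat_coe]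
  push_cast
  rfl

lemma prod_add_single (f : ℕ+ → ℕ → ℂ) (hf : ∀ n, f n 0 = 1) (l : ℕ+ →₀ ℕ) (n : ℕ+) :
    ∃ R, l.prod f = f n (l n) * R ∧ (l + Finsupp.single n 1).prod f = f n (l n + 1) * R := by
  classical
  refine ⟨∏ m ∈ l.support.erase n, f m (l m), ?_, ?_⟩
  · rw [Finsupp.prod_of_support_subset l (Finset.subset_insert n l.support) f fun m _ => hf m,
      ← Finset.mul_prod_erase _ _ (Finset.mem_insert_self n _), Finset.erase_insert_eq_erase]
  · rw [Finsupp.prod_of_support_subset (s := insert n l.support) _ ?_ f fun m _ => hf m,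
      ← Finset.mul_prod_erase _ _ (Finset.mem_insert_self n _), Finset.erase_insert_eq_erase]
    · congr 1
      · simp
      · refine Finset.prod_congr rfl fun m hm => ?_
        have : m ≠ n := Finset.ne_of_mem_erase hm
        simp [this.symm]
    · intro m hm
      by_cases h : m = n
      · rw [h]; exact Finset.mem_insert_self n _
      · refine Finset.mem_insert_of_mem ?_
        rw [Finsupp.mem_support_iff] at hm ⊢
        simpa [Ne.symm h] using hm

/-- The divided power `∏ (b n a(-n))^{l n} / (l n)!` of creation operators. -/
noncomputable def creationPow (b : ℕ+ → ℂ) (l : ℕ+ →₀ ℕ) : Module.End ℂ GenFock :=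
  Finsupp.mapRange.linearMap (LinearMap.mulLeft ℂ
    (MvPolynomial.monomial l (l.prod fun n k => b n ^ k / (k.factorial : ℂ)) : Fock))

lemma creationPow_basisVec (b : ℕ+ → ℂ) (l N : ℕ+ →₀ ℕ) (μ : ℂ) :
    creationPow b l (basisVec μ N) =
      (l.prod fun n k => b n ^ k / (k.factorial : ℂ)) • basisVec μ (N + l) := by
  rw [smul_basisVec]
  simp only [creationPow, basisVec, Finsupp.mapRange.linearMap_apply, Finsupp.mapRange_single,
    LinearMap.mulLeft_apply, MvPolynomial.monomial_mul, mul_one]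
  rw [add_comm]

/-- The divided power `∏ (c n ∂/∂(a(-n)))^{l n} / (l n)!` of annihilation operators. -/
noncomputable def annihilationPow (c : ℕ+ → ℂ) (l : ℕ+ →₀ ℕ) : Module.End ℂ GenFock :=
  Finsupp.mapRange.linearMap ((MvPolynomial.basisMonomials ℕ+ ℂ).constr ℂ fun N =>
    MvPolynomial.monomial (N - l) (l.prod fun n k => c n ^ k * ((N n).choose k : ℂ)))

lemma annihilationPow_basisVec (c : ℕ+ → ℂ) (l N : ℕ+ →₀ ℕ) (μ : ℂ) :
    annihilationPow c l (basisVec μ N) =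
      (l.prod fun n k => c n ^ k * ((N n).choose k : ℂ)) • basisVec μ (N - l) := by
  rw [smul_basisVec]
  simp only [annihilationPow, basisVec, Finsupp.mapRange.linearMap_apply, Finsupp.mapRange_single]
  congr 1
  exact (MvPolynomial.basisMonomials ℕ+ ℂ).constr_basis ℂ _ N

lemma coeff_Yminus (β : ℂ) (k : ℕ) : PowerSeries.coeff k (Yminus β) =
    ∑ l ∈ multiIdx k, creationPow (fun n => β / ((n : ℕ) : ℂ)) l := by
  have hcoeff : ∀ n : ℕ+, PowerSeries.coeff (n : ℕ) (PowerSeries.mk fun n : ℕ =>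
      if n = 0 then (0 : Module.End ℂ GenFock) else (β / (n : ℂ)) • heis (-(n : ℤ))) =
      (β / ((n : ℕ) : ℂ)) • heis (-((n : ℕ) : ℤ)) := fun n => by
    rw [PowerSeries.coeff_mk, if_neg n.ne_zero]
  have h0 : PowerSeries.coeff 0 (PowerSeries.mk fun n : ℕ =>
      if n = 0 then (0 : Module.End ℂ GenFock) else (β / (n : ℂ)) • heis (-(n : ℤ))) = 0 := by
    rw [PowerSeries.coeff_mk, if_pos rfl]
  have hY : PowerSeries.coeff k (Yminus β) = expCoeff (PowerSeries.mk fun n : ℕ =>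
      if n = 0 then (0 : Module.End ℂ GenFock) else (β / (n : ℂ)) • heis (-(n : ℤ))) k := by
    rw [Yminus, expSeries, PowerSeries.coeff_mk]
    rfl
  rw [hY]
  refine expCoeff_eq_sum_multiIdx h0 ?_ _ ?_ ?_ k
  · intro i j
    rcases Nat.eq_zero_or_pos i with rfl | hi
    · rw [h0]; exact Commute.zero_left _
    rcases Nat.eq_zero_or_pos j with rfl | hj
    · rw [h0]; exact Commute.zero_right _
    lift i to ℕ+ using hi
    lift j to ℕ+ using hj
    rw [hcoeff, hcoeff]
    refine Commute.smul_left (Commute.smul_right ?_ _) _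
    refine genFock_end_ext fun μ N => ?_
    simp only [Module.End.mul_apply, heis_neg_basisVec]
    rw [add_right_comm]
  · refine genFock_end_ext fun μ N => ?_
    rw [creationPow_basisVec]
    simp
  · intro n l
    refine genFock_end_ext fun μ N => ?_
    obtain ⟨R, hR1, hR2⟩ := prod_add_single
      (fun n k => (β / ((n : ℕ) : ℂ)) ^ k / (k.factorial : ℂ)) (fun n => by simp) l n
    rw [hcoeff, Module.End.mul_apply, LinearMap.smul_apply, LinearMap.smul_apply,
      creationPow_basisVec, creationPow_basisVec, map_smul, heis_neg_basisVec, smul_smul,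
      ← Nat.cast_smul_eq_nsmul ℂ (l n + 1), smul_smul, hR1, hR2, add_assoc]
    congr 1
    have h1 : ((l n : ℂ) + 1) ≠ 0 := Nat.cast_add_one_ne_zero _
    have h2 : ((l n).factorial : ℂ) ≠ 0 := Nat.cast_ne_zero.2 (Nat.factorial_ne_zero _)
    rw [Nat.factorial_succ, pow_succ]
    push_cast
    field_simp

lemma coeff_Yplus (β : ℂ) (k : ℕ) : PowerSeries.coeff k (Yplus β) =
    ∑ l ∈ multiIdx k, annihilationPow (fun _ => -β) l := by
  have hcoeff : ∀ n : ℕ+, PowerSeries.coeff (n : ℕ) (PowerSeries.mk fun n : ℕ =>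
      if n = 0 then (0 : Module.End ℂ GenFock) else (-β / (n : ℂ)) • heis (n : ℤ)) =
      (-β / ((n : ℕ) : ℂ)) • heis ((n : ℕ) : ℤ) := fun n => by
    rw [PowerSeries.coeff_mk, if_neg n.ne_zero]
  have h0 : PowerSeries.coeff 0 (PowerSeries.mk fun n : ℕ =>
      if n = 0 then (0 : Module.End ℂ GenFock) else (-β / (n : ℂ)) • heis (n : ℤ)) = 0 := by
    rw [PowerSeries.coeff_mk, if_pos rfl]
  have hY : PowerSeries.coeff k (Yplus β) = expCoeff (PowerSeries.mk fun n : ℕ =>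
      if n = 0 then (0 : Module.End ℂ GenFock) else (-β / (n : ℂ)) • heis (n : ℤ)) k := by
    rw [Yplus, expSeries, PowerSeries.coeff_mk]
    rfl
  rw [hY]
  refine expCoeff_eq_sum_multiIdx h0 ?_ _ ?_ ?_ k
  · intro i j
    rcases Nat.eq_zero_or_pos i with rfl | hi
    · rw [h0]; exact Commute.zero_left _
    rcases Nat.eq_zero_or_pos j with rfl | hj
    · rw [h0]; exact Commute.zero_right _
    lift i to ℕ+ using hi
    lift j to ℕ+ using hj
    rw [hcoeff, hcoeff]
    refine Commute.smul_left (Commute.smul_right ?_ _) _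
    by_cases hij : i = j
    · rw [hij]; exact Commute.refl _
    refine genFock_end_ext fun μ N => ?_
    simp only [Module.End.mul_apply, heis_pos_basisVec, map_smul, smul_smul]
    rw [tsub_right_comm]
    congr 1
    simp [hij, Ne.symm hij]
    ring
  · refine genFock_end_ext fun μ N => ?_
    rw [annihilationPow_basisVec]
    simp
  · intro n l
    refine genFock_end_ext fun μ N => ?_
    obtain ⟨R, hR1, hR2⟩ := prod_add_single
      (fun n k => (-β) ^ k * ((N n).choose k : ℂ)) (fun n => by simp) l n
    rw [hcoeff, Module.End.mul_apply, LinearMap.smul_apply, LinearMap.smul_apply,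
      annihilationPow_basisVec, annihilationPow_basisVec, map_smul, heis_pos_basisVec, smul_smul,
      smul_smul, ← Nat.cast_smul_eq_nsmul ℂ (l n + 1), smul_smul, hR1, hR2, tsub_tsub]
    congr 1
    have h1 : ((n : ℕ) : ℂ) ≠ 0 := Nat.cast_ne_zero.2 n.ne_zero
    have h2 : ((N n).choose (l n + 1) : ℂ) * ((l n : ℂ) + 1) =
        ((N n).choose (l n) : ℂ) * ((N n - l n : ℕ) : ℂ) := by
      exact_mod_cast Nat.choose_succ_right_eq (N n) (l n)
    rw [Finsupp.tsub_apply]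
    field_simp
    push_cast
    linear_combination (-β) ^ (l n + 1) * R * (-h2)

/-- The coefficient of `a(-n)` in the exponent of the vertex operator of `e^β` at `e^ζ`,
where `a = (β, ζ)`. -/
noncomputable def creationCoeff (n : ℕ+) (a : ℂ × ℂ) : ℂ :=
  a.1 * Complex.exp (a.2) ^ (n : ℕ) / ((n : ℕ) : ℂ)

/-- The coefficient of `∂/∂(a(-n)) = a(n) / n` in the exponent of the vertex operator of `e^β` at
`e^ζ`, where `a = (β, ζ)`. -/
noncomputable def annihilationCoeff (n : ℕ+) (a : ℂ × ℂ) : ℂ :=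
  -a.1 * Complex.exp (-a.2) ^ (n : ℕ)

lemma prod_pow_mul (x : ℂ) (f : ℕ+ → ℕ → ℂ) (l : ℕ+ →₀ ℕ) :
    (l.prod fun n k => (x ^ (n : ℕ)) ^ k * f n k) = x ^ multiDeg l * l.prod f := by
  rw [Finsupp.prod_mul, multiDeg, Finsupp.sum, ← Finset.prod_pow_eq_pow_sum]
  congr 1
  exact Finset.prod_congr rfl fun n _ => (pow_mul _ _ _).symm

lemma expChargeOp_basisVec (s μ : ℂ) (N : ℕ+ →₀ ℕ) :
    expChargeOp s (basisVec μ N) = Complex.exp (s * μ) • basisVec μ N := by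
  simp [expChargeOp, basisVec]

lemma shiftOp_basisVec (β μ : ℂ) (N : ℕ+ →₀ ℕ) :
    shiftOp β (basisVec μ N) = basisVec (μ + β) N := by
  simp [shiftOp, basisVec, Finsupp.lmapDomain_apply, Finsupp.mapDomain_single]

lemma vertexTerm_basisVec (a : ℂ × ℂ) (k l : ℕ) (μ : ℂ) (N : ℕ+ →₀ ℕ) :
    vertexTerm a.1 a.2 k l (basisVec μ N) =
      ∑ x ∈ multiIdx k ×ˢ multiIdx l,
        (Complex.exp (a.2 * weight a.1 0 + a.2 * a.1 * μ) *
          ((x.1.prod fun n k => creationCoeff n a ^ k / (k.factorial : ℂ)) *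
            (x.2.prod fun n k => annihilationCoeff n a ^ k * ((N n).choose k : ℂ)))) •
          basisVec (μ + a.1) (N - x.2 + x.1) := by
  rw [vertexTerm, mul_assoc (shiftOp a.1), coeff_Yminus, coeff_Yplus, Finset.sum_mul_sum,
    ← Finset.sum_product', LinearMap.smul_apply, Module.End.mul_apply, expChargeOp_basisVec,
    map_smul, Module.End.mul_apply, LinearMap.sum_apply, map_sum, Finset.smul_sum,
    Finset.smul_sum]
  refine Finset.sum_congr rfl fun x hx => ?_
  obtain ⟨hk, hl⟩ := Finset.mem_product.1 hx
  rw [mem_multiIdx] at hk hl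
  rw [Module.End.mul_apply, annihilationPow_basisVec, map_smul, creationPow_basisVec, map_smul,
    map_smul, shiftOp_basisVec, smul_smul, smul_smul, smul_smul]
  congr 1
  have h1 : (x.1.prod fun n k => creationCoeff n a ^ k / (k.factorial : ℂ)) =
      Complex.exp a.2 ^ k * x.1.prod fun n k => (a.1 / ((n : ℕ) : ℂ)) ^ k / (k.factorial : ℂ) := by
    rw [← hk, ← prod_pow_mul]
    refine Finsupp.prod_congr fun n _ => ?_
    rw [creationCoeff, mul_comm a.1, mul_div_assoc, mul_pow]
    ring
  have h2 : (x.2.prod fun n k => annihilationCoeff n a ^ k * ((N n).choose k : ℂ)) =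
      Complex.exp (-a.2) ^ l * x.2.prod fun n k => (-a.1) ^ k * ((N n).choose k : ℂ) := by
    rw [← hl, ← prod_pow_mul]
    refine Finsupp.prod_congr fun n _ => ?_
    rw [annihilationCoeff, mul_comm (-a.1), mul_pow]
    ring
  have h3 : Complex.exp (((k : ℂ) - (l : ℂ)) * a.2) =
      Complex.exp a.2 ^ k * Complex.exp (-a.2) ^ l := by
    rw [← Complex.exp_nat_mul, ← Complex.exp_nat_mul, ← Complex.exp_add]
    congr 1
    ring
  rw [h1, h2, h3, Complex.exp_add]
  ring

end VertexOperators

/-! ### Factorisation of the matrix elements over the modes -/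

section Factorisation

/-- The exponent of the Fock monomial with exponent `N` after the entries of `L`, from right to
left, have removed the quanta `ρ` and added the quanta `λ`, where `(λ, ρ)` is the entry of `P`. -/
noncomputable def fockOut {α : Type*} : (L : List α) →
    (Fin L.length → (ℕ+ →₀ ℕ) × (ℕ+ →₀ ℕ)) → (ℕ+ →₀ ℕ) → (ℕ+ →₀ ℕ)
  | [], _, N => N
  | _ :: L, P, N => fockOut L (Fin.tail P) N - (P 0).2 + (P 0).1

/-- The oscillator part of the amplitude of the transition from `N` to `fockOut L P N`. -/
noncomputable def fockAmp : (L : List (ℂ × ℂ)) →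
    (Fin L.length → (ℕ+ →₀ ℕ) × (ℕ+ →₀ ℕ)) → (ℕ+ →₀ ℕ) → ℂ
  | [], _, _ => 1
  | a :: L, P, N =>
      (((P 0).1.prod fun n k => creationCoeff n a ^ k / (k.factorial : ℂ)) *
        ((P 0).2.prod fun n k =>
          annihilationCoeff n a ^ k * ((fockOut L (Fin.tail P) N n).choose k : ℂ))) *
      fockAmp L (Fin.tail P) N

/-- The total charge of a list of insertions. -/
def chargeSum (L : List (ℂ × ℂ)) : ℂ := (L.map Prod.fst).sum

/-- The zero mode part of the amplitude on the sector of charge `μ`. -/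
noncomputable def zeroModeAmp : List (ℂ × ℂ) → ℂ → ℂ
  | [], _ => 1
  | a :: L, μ => Complex.exp (a.2 * weight a.1 0 + a.2 * a.1 * (μ + chargeSum L)) * zeroModeAmp L μ

lemma sum_piFinset_succ {A M : Type*} [DecidableEq A] [AddCommMonoid M] {r : ℕ}
    (D : Fin (r + 1) → Finset A) (g : A → (Fin r → A) → M) :
    ∑ P ∈ Fintype.piFinset D, g (P 0) (Fin.tail P) =
      ∑ P ∈ Fintype.piFinset (Fin.tail D), ∑ x ∈ D 0, g x P := by
  rw [← Finset.sum_product']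
  refine Finset.sum_nbij' (fun P => (Fin.tail P, P 0)) (fun x => Fin.cons x.2 x.1) ?_ ?_ ?_ ?_ ?_
  · intro P hP
    rw [Fintype.mem_piFinset] at hP
    exact Finset.mem_product.2 ⟨Fintype.mem_piFinset.2 fun i => hP i.succ, hP 0⟩
  · intro x hx
    obtain ⟨h1, h2⟩ := Finset.mem_product.1 hx
    refine Fintype.mem_piFinset.2 fun i => ?_
    refine Fin.cases ?_ (fun j => ?_) i
    · simpa using h2
    · exact Fintype.mem_piFinset.1 h1 j
  · intro P _
    exact Fin.cons_self_tail P
  · intro x _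
    simp
  · intro P _
    rfl

open Classical in
lemma prod_vertexTerm_basisVec (L : List (ℂ × ℂ)) (p : Fin L.length → ℕ × ℕ) (μ : ℂ)
    (N : ℕ+ →₀ ℕ) :
    (List.ofFn fun i : Fin L.length =>
        vertexTerm (L.get i).1 (L.get i).2 (p i).1 (p i).2).prod (basisVec μ N) =
      ∑ P ∈ Fintype.piFinset fun i => multiIdx (p i).1 ×ˢ multiIdx (p i).2,
        (zeroModeAmp L μ * fockAmp L P N) • basisVec (μ + chargeSum L) (fockOut L P N) := by
  induction L with
  | nil =>
    have : Unique (Fin ([] : List (ℂ × ℂ)).length → (ℕ+ →₀ ℕ) × (ℕ+ →₀ ℕ)) :=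
      inferInstanceAs (Unique (Fin 0 → _))
    rw [Finset.sum_congr (Finset.eq_univ_of_forall fun P => Fintype.mem_piFinset.2 fun i => i.elim0)
      fun _ _ => rfl, Fintype.sum_unique]
    simp [zeroModeAmp, fockAmp, fockOut, chargeSum]
  | cons a L ih =>
    have h1 : (List.ofFn fun i : Fin (a :: L).length =>
        vertexTerm ((a :: L).get i).1 ((a :: L).get i).2 (p i).1 (p i).2).prod =
        vertexTerm a.1 a.2 (p 0).1 (p 0).2 * (List.ofFn fun i : Fin L.length =>
          vertexTerm (L.get i).1 (L.get i).2 (Fin.tail p i).1 (Fin.tail p i).2).prod := by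
      refine (congrArg List.prod (List.ofFn_succ (n := L.length))).trans ?_
      rw [List.prod_cons]
      rfl
    rw [h1, Module.End.mul_apply, ih (Fin.tail p), map_sum]
    have h2 := sum_piFinset_succ (r := L.length)
      (fun i : Fin (L.length + 1) => multiIdx (p i).1 ×ˢ multiIdx (p i).2)
      (fun x P => (Complex.exp (a.2 * weight a.1 0 + a.2 * a.1 * (μ + chargeSum L)) *
          zeroModeAmp L μ * (((x.1.prod fun n k => creationCoeff n a ^ k / (k.factorial : ℂ)) *
            (x.2.prod fun n k =>
              annihilationCoeff n a ^ k * ((fockOut L P N n).choose k : ℂ))) *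
          fockAmp L P N)) • basisVec (μ + chargeSum (a :: L)) (fockOut L P N - x.2 + x.1))
    refine Eq.trans ?_ h2.symm
    refine Finset.sum_congr rfl fun P _ => ?_
    rw [map_smul, vertexTerm_basisVec, Finset.smul_sum]
    refine Finset.sum_congr rfl fun x _ => ?_
    rw [smul_smul]
    congr 1
    · ring
    · congr 1
      simp [chargeSum]
      ring

/-- The occupation numbers of mode `n`. -/
def atMode {ι : Type*} (P : ι → (ℕ+ →₀ ℕ) × (ℕ+ →₀ ℕ)) (n : ℕ+) (i : ι) : ℕ × ℕ :=
  ((P i).1 n, (P i).2 n)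

lemma fockOut_apply {α : Type*} (L : List α) (P : Fin L.length → (ℕ+ →₀ ℕ) × (ℕ+ →₀ ℕ))
    (N : ℕ+ →₀ ℕ) (n : ℕ+) : fockOut L P N n = modeOut L (atMode P n) (N n) := by
  induction L with
  | nil => rfl
  | cons a L ih =>
    have := ih (Fin.tail P)
    simp only [fockOut, modeOut, Finsupp.add_apply, Finsupp.tsub_apply, this]
    rfl

lemma fockAmp_eq_prod (L : List (ℂ × ℂ)) (P : Fin L.length → (ℕ+ →₀ ℕ) × (ℕ+ →₀ ℕ))
    (N : ℕ+ →₀ ℕ) (S : Finset ℕ+) (hS : ∀ i, (P i).1.support ⊆ S ∧ (P i).2.support ⊆ S) :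
    fockAmp L P N =
      ∏ n ∈ S, modeAmp (creationCoeff n) (annihilationCoeff n) L (atMode P n) (N n) := by
  induction L with
  | nil => simp [fockAmp, modeAmp]
  | cons a L ih =>
    have h := ih (Fin.tail P) fun i => hS i.succ
    simp only [fockAmp, modeAmp]
    rw [Finset.prod_mul_distrib, Finset.prod_mul_distrib, h,
      Finsupp.prod_of_support_subset _ (hS (0 : Fin (L.length + 1))).1 _ fun n _ => by simp,
      Finsupp.prod_of_support_subset _ (hS (0 : Fin (L.length + 1))).2 _ fun n _ => by simp]
    simp only [fockOut_apply]
    rfl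

/-- Families of multi-indices are finitely supported families of occupation numbers. -/
noncomputable def occupationEquiv (r : ℕ) :
    (ℕ+ →₀ ℕ × (Fin r → ℕ × ℕ)) ≃ (ℕ+ →₀ ℕ) × (Fin r → (ℕ+ →₀ ℕ) × (ℕ+ →₀ ℕ)) where
  toFun f := (f.mapRange Prod.fst rfl, fun i =>
    (f.mapRange (fun x => (x.2 i).1) rfl, f.mapRange (fun x => (x.2 i).2) rfl))
  invFun x := Finsupp.onFinset
    (x.1.support ∪ Finset.univ.biUnion fun i => (x.2 i).1.support ∪ (x.2 i).2.support)
    (fun n => (x.1 n, atMode x.2 n)) (by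
      intro n hn
      by_contra h
      simp only [Finset.mem_union, Finset.mem_biUnion, Finset.mem_univ, true_and, not_or,
        not_exists, Finsupp.notMem_support_iff] at h
      refine hn (Prod.ext h.1 (funext fun i => ?_))
      exact Prod.ext (h.2 i).1 (h.2 i).2)
  left_inv f := by ext n <;> rfl
  right_inv x := by
    refine Prod.ext ?_ (funext fun i => Prod.ext ?_ ?_) <;> ext n <;> rfl

lemma modeOut_zero {α : Type*} (L : List α) : modeOut L (0 : Fin L.length → ℕ × ℕ) 0 = 0 := by
  induction L with
  | nil => rfl
  | cons a L ih =>
    change modeOut L 0 0 - 0 + 0 = 0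
    simpa using ih

/-- The contribution of a diagonal transition to the oscillator part of the trace. -/
noncomputable def fockDiag (L : List (ℂ × ℂ)) (q : ℂ)
    (x : (ℕ+ →₀ ℕ) × (Fin L.length → (ℕ+ →₀ ℕ) × (ℕ+ →₀ ℕ))) : ℂ :=
  if fockOut L x.2 x.1 = x.1 then fockAmp L x.2 x.1 * q ^ multiDeg x.1 else 0

lemma fockDiag_occupationEquiv (L : List (ℂ × ℂ)) (q : ℂ)
    (f : ℕ+ →₀ ℕ × (Fin L.length → ℕ × ℕ)) :
    fockDiag L q (occupationEquiv L.length f) = f.prod fun n x =>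
      modeDiag (creationCoeff n) (annihilationCoeff n) L (q ^ (n : ℕ)) x := by
  set P := (occupationEquiv L.length f).2 with hP
  set N := (occupationEquiv L.length f).1 with hN
  have hPn : ∀ n, atMode P n = (f n).2 := fun n => rfl
  have hNn : ∀ n, N n = (f n).1 := fun n => rfl
  have hS : ∀ i, (P i).1.support ⊆ f.support ∧ (P i).2.support ⊆ f.support := fun i =>
    ⟨Finsupp.support_mapRange (hf := rfl), Finsupp.support_mapRange (hf := rfl)⟩
  have hdeg : q ^ multiDeg N = ∏ n ∈ f.support, (q ^ (n : ℕ)) ^ (f n).1 := by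
    rw [multiDeg, Finsupp.sum_of_support_subset N (s := f.support)
      (Finsupp.support_mapRange (hf := rfl)) _
      fun _ _ => by simp, ← Finset.prod_pow_eq_pow_sum]
    exact Finset.prod_congr rfl fun n _ => pow_mul _ _ _
  have hout : fockOut L P N = N ↔ ∀ n ∈ f.support, modeOut L (f n).2 (f n).1 = (f n).1 := by
    rw [Finsupp.ext_iff]
    refine ⟨fun h n _ => ?_, fun h n => ?_⟩
    · rw [← hPn, ← hNn, ← fockOut_apply, h n]
    · by_cases hn : n ∈ f.support
      · rw [fockOut_apply, hPn, hNn, h n hn]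
      · rw [fockOut_apply, hPn, hNn, Finsupp.notMem_support_iff.1 hn]
        exact modeOut_zero L
  rw [fockDiag, Finsupp.prod]
  by_cases h : fockOut L P N = N
  · rw [if_pos h, fockAmp_eq_prod L P N f.support hS, hdeg, ← Finset.prod_mul_distrib]
    refine Finset.prod_congr rfl fun n hn => ?_
    rw [modeDiag, if_pos (hout.1 h n hn), hPn, hNn]
  · rw [if_neg h]
    rw [hout] at h
    push Not at h
    obtain ⟨n, hn, hne⟩ := h
    rw [Finset.prod_eq_zero hn]
    rw [modeDiag, if_neg hne]

lemma modeDiag_zero {α : Type*} (b c : α → ℂ) (L : List α) (Q : ℂ) : modeDiag b c L Q 0 = 1 := by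
  have h2 : modeAmp b c L (0 : Fin L.length → ℕ × ℕ) 0 = 1 := by
    induction L with
    | nil => rfl
    | cons a L ih =>
      have h3 : Fin.tail (0 : Fin (a :: L).length → ℕ × ℕ) = 0 := rfl
      simp [modeAmp, h3, ih]
  simp [modeDiag, modeOut_zero, h2]

end Factorisation

/-! ### The sum of the one-mode exponents -/

section PairSum

variable {α : Type*}

lemma pairSum_add (f g : α → α → ℂ) (L : List α) :
    pairSum (fun a b => f a b + g a b) L = pairSum f L + pairSum g L := by
  induction L with
  | nil => simp [pairSum]
  | cons a L ih => simp only [pairSum, ih, List.sum_map_add]; ring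

lemma pairSum_mul_left (c : ℂ) (f : α → α → ℂ) (L : List α) :
    pairSum (fun a b => c * f a b) L = c * pairSum f L := by
  induction L with
  | nil => simp [pairSum]
  | cons a L ih => simp only [pairSum, ih, List.sum_map_mul_left]; ring

lemma sum_mul_sum_eq_pairSum (f g : α → ℂ) (L : List α) :
    (L.map f).sum * (L.map g).sum =
      (L.map fun a => f a * g a).sum + pairSum (fun a b => f a * g b + f b * g a) L := by
  induction L with
  | nil => simp [pairSum]
  | cons a L ih =>
    simp only [pairSum, List.map_cons, List.sum_cons, List.sum_map_add, List.sum_map_mul_left,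
      List.sum_map_mul_right]
    linear_combination ih

lemma hasSum_list_sum {ι : Type*} {f : ι → α → ℂ} {g : α → ℂ} {L : List α}
    (h : ∀ a ∈ L, HasSum (fun n => f n a) (g a)) :
    HasSum (fun n => (L.map (f n)).sum) (L.map g).sum := by
  induction L with
  | nil => simp
  | cons a L ih =>
    simp only [List.map_cons, List.sum_cons]
    exact (h a List.mem_cons_self).add (ih fun b hb => h b (List.mem_cons_of_mem _ hb))

lemma hasSum_pairSum {ι : Type*} {f : ι → α → α → ℂ} {g : α → α → ℂ} {L : List α}
    (h : L.Pairwise fun a b => HasSum (fun n => f n a b) (g a b)) :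
    HasSum (fun n => pairSum (f n) L) (pairSum g L) := by
  induction L with
  | nil => simp [pairSum]
  | cons a L ih =>
    obtain ⟨h1, h2⟩ := List.pairwise_cons.1 h
    exact (hasSum_list_sum h1).add (ih h2)

lemma pairSum_map {β : Type*} (φ : β → α) (f : α → α → ℂ) (L : List β) :
    pairSum f (L.map φ) = pairSum (fun a b => f (φ a) (φ b)) L := by
  induction L with
  | nil => rfl
  | cons a L ih =>
    simp only [pairSum, List.map_cons, List.map_map, ih]
    rfl

end PairSum

section Propagator

/-- The `n`-th term of the even part of the logarithm of the prime form; it collects the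
contractions that wind around the torus. -/
noncomputable def windingTerm (q : ℂ) (n : ℕ+) (z : ℂ) : ℂ :=
  -(Complex.exp z ^ (n : ℕ) + Complex.exp (-z) ^ (n : ℕ) - 2) * q ^ (n : ℕ) /
    (1 - q ^ (n : ℕ)) / ((n : ℕ) : ℂ)

/-- The even part of the logarithm of the prime form, as a series over the modes. -/
noncomputable def winding (q z : ℂ) : ℂ := ∑' n : ℕ+, windingTerm q n z

/-- The logarithm of the prime form on the strip where `1 < |e^z| < |q|⁻¹`. -/
noncomputable def logPrime (q z : ℂ) : ℂ :=
  z / 2 + Complex.log (1 - Complex.exp (-z)) + winding q z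

lemma norm_one_sub_pow_ge {q : ℂ} (hq : ‖q‖ < 1) (n : ℕ+) : 1 - ‖q‖ ≤ ‖1 - q ^ (n : ℕ)‖ := by
  have h1 : ‖q ^ (n : ℕ)‖ ≤ ‖q‖ := by
    rw [norm_pow]
    exact pow_le_of_le_one (norm_nonneg _) hq.le n.ne_zero
  have h2 := norm_sub_norm_le (1 : ℂ) (q ^ (n : ℕ))
  rw [norm_one] at h2
  linarith

lemma one_sub_pow_ne_zero {q : ℂ} (hq : ‖q‖ < 1) (n : ℕ+) : 1 - q ^ (n : ℕ) ≠ 0 := by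
  have h := norm_one_sub_pow_ge hq n
  intro h0
  rw [h0, norm_zero] at h
  linarith

lemma summable_pnat_geometric {r : ℝ} (h0 : 0 ≤ r) (h1 : r < 1) :
    Summable fun n : ℕ+ => r ^ (n : ℕ) :=
  (summable_geometric_of_lt_one h0 h1).comp_injective PNat.coe_injective

lemma norm_windingTerm_le {q : ℂ} (hq : ‖q‖ < 1) {z : ℂ} {s : ℝ} (hs : |z.re| ≤ s) (n : ℕ+) :
    ‖windingTerm q n z‖ ≤ 4 / (1 - ‖q‖) * (‖q‖ * Real.exp s) ^ (n : ℕ) := by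
  have hs0 : 0 ≤ s := (abs_nonneg _).trans hs
  have hE : (1 : ℝ) ≤ Real.exp s ^ (n : ℕ) := one_le_pow₀ (Real.one_le_exp hs0)
  have e1 : ‖Complex.exp z ^ (n : ℕ)‖ ≤ Real.exp s ^ (n : ℕ) := by
    rw [norm_pow, Complex.norm_exp]
    exact pow_le_pow_left₀ (Real.exp_pos _).le (Real.exp_le_exp.2 ((le_abs_self _).trans hs)) _
  have e2 : ‖Complex.exp (-z) ^ (n : ℕ)‖ ≤ Real.exp s ^ (n : ℕ) := by
    rw [norm_pow, Complex.norm_exp, Complex.neg_re]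
    exact pow_le_pow_left₀ (Real.exp_pos _).le (Real.exp_le_exp.2 ((neg_le_abs _).trans hs)) _
  have e3 : ‖Complex.exp z ^ (n : ℕ) + Complex.exp (-z) ^ (n : ℕ) - 2‖ ≤
      4 * Real.exp s ^ (n : ℕ) := by
    refine (norm_sub_le _ _).trans ?_
    have := norm_add_le (Complex.exp z ^ (n : ℕ)) (Complex.exp (-z) ^ (n : ℕ))
    have h2 : ‖(2 : ℂ)‖ = 2 := by simp
    linarith
  have hpos : 0 < 1 - ‖q‖ := by linarith
  have hn : (1 : ℝ) ≤ ((n : ℕ) : ℝ) := by exact_mod_cast one_le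
  rw [windingTerm, norm_div, norm_div, norm_mul, norm_neg, Complex.norm_natCast, norm_pow,
    mul_pow]
  have hge := norm_one_sub_pow_ge hq n
  calc _ ≤ ‖Complex.exp z ^ (n : ℕ) + Complex.exp (-z) ^ (n : ℕ) - 2‖ * ‖q‖ ^ (n : ℕ) /
        ‖1 - q ^ (n : ℕ)‖ := div_le_self (by positivity) hn
    _ ≤ 4 * Real.exp s ^ (n : ℕ) * ‖q‖ ^ (n : ℕ) / (1 - ‖q‖) := by gcongr
    _ = _ := by ring

lemma summable_windingTerm {q : ℂ} (hq : ‖q‖ < 1) {z : ℂ} (hz : ‖q‖ * Real.exp |z.re| < 1) :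
    Summable fun n => windingTerm q n z :=
  Summable.of_norm_bounded ((summable_pnat_geometric (by positivity) hz).mul_left _)
    fun n => norm_windingTerm_le hq le_rfl n

/-- The coefficient of `a.1 * b.1` in the one-mode exponent. -/
noncomputable def contractionTerm (q : ℂ) (n : ℕ+) (z : ℂ) : ℂ :=
  windingTerm q n z - Complex.exp (-z) ^ (n : ℕ) / ((n : ℕ) : ℂ)

lemma hasSum_pnat_pow_div {x : ℂ} (hx : ‖x‖ < 1) :
    HasSum (fun n : ℕ+ => x ^ (n : ℕ) / ((n : ℕ) : ℂ)) (-Complex.log (1 - x)) := by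
  refine (PNat.coe_injective.hasSum_iff (f := fun n : ℕ => x ^ n / (n : ℂ)) ?_).2
    (Complex.hasSum_taylorSeries_neg_log hx)
  intro n hn
  have : n = 0 := by
    by_contra h
    exact hn ⟨⟨n, Nat.pos_of_ne_zero h⟩, rfl⟩
  simp [this]

lemma hasSum_contractionTerm {q : ℂ} (hq : ‖q‖ < 1) {z : ℂ} (h0 : 0 < z.re)
    (hz : ‖q‖ * Real.exp z.re < 1) :
    HasSum (fun n => contractionTerm q n z)
      (Complex.log (1 - Complex.exp (-z)) + winding q z) := by
  have hlt : ‖Complex.exp (-z)‖ < 1 := by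
    rw [Complex.norm_exp, Complex.neg_re]
    exact Real.exp_lt_one_iff.2 (by linarith)
  have h1 := hasSum_pnat_pow_div hlt
  have h2 := (summable_windingTerm hq (z := z) (by rwa [abs_of_pos h0])).hasSum.sub h1
  rwa [sub_neg_eq_add, add_comm] at h2

/-- The one-mode exponent as a sum over pairs of insertions. The correction is proportional to the
square of the total charge. -/
lemma modeExponent_eq {q : ℂ} (hq : ‖q‖ < 1) (n : ℕ+) (L : List (ℂ × ℂ)) :
    modeExponent (creationCoeff n) (annihilationCoeff n) L (q ^ (n : ℕ)) =
      pairSum (fun a b => a.1 * b.1 * contractionTerm q n (a.2 - b.2)) L -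
        chargeSum L ^ 2 * (q ^ (n : ℕ) / (1 - q ^ (n : ℕ)) / ((n : ℕ) : ℂ)) := by
  have hn : ((n : ℕ) : ℂ) ≠ 0 := Nat.cast_ne_zero.2 n.ne_zero
  have h1q := one_sub_pow_ne_zero hq n
  set Q := q ^ (n : ℕ)
  have hexp : ∀ u v : ℂ, Complex.exp u ^ (n : ℕ) * Complex.exp (-v) ^ (n : ℕ) =
      Complex.exp (u - v) ^ (n : ℕ) := fun u v => by
    rw [← mul_pow, ← Complex.exp_add, sub_eq_add_neg]
  have hinv : ∀ u : ℂ, Complex.exp u ^ (n : ℕ) * Complex.exp (-u) ^ (n : ℕ) = 1 := fun u => by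
    rw [hexp, sub_self, Complex.exp_zero, one_pow]
  have hdiag : (L.map fun a => creationCoeff n a * annihilationCoeff n a).sum =
      -(1 / ((n : ℕ) : ℂ)) * (L.map fun a : ℂ × ℂ => a.1 * a.1).sum := by
    rw [← List.sum_map_mul_left]
    congr 2
    funext a
    rw [creationCoeff, annihilationCoeff]
    linear_combination (-(a.1 * a.1 / ((n : ℕ) : ℂ))) * hinv a.2
  have hsq : chargeSum L ^ 2 = (L.map fun a : ℂ × ℂ => a.1 * a.1).sum +
      pairSum (fun a b => 2 * (a.1 * b.1)) L := by
    rw [sq, chargeSum, sum_mul_sum_eq_pairSum]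
    congr 1
    congr 1
    funext a b
    ring
  have hpair : pairSum (fun a b => a.1 * b.1 * contractionTerm q n (a.2 - b.2)) L =
      pairSum (fun a b => annihilationCoeff n a * creationCoeff n b) L +
      Q / (1 - Q) * pairSum (fun a b => creationCoeff n a * annihilationCoeff n b +
        creationCoeff n b * annihilationCoeff n a) L +
      Q / (1 - Q) / ((n : ℕ) : ℂ) * pairSum (fun a b => 2 * (a.1 * b.1)) L := by
    rw [← pairSum_mul_left, ← pairSum_mul_left, ← pairSum_add, ← pairSum_add]
    congr 1
    funext a b
    have h1 := hexp a.2 b.2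
    have h2 := hexp b.2 a.2
    rw [contractionTerm, windingTerm, creationCoeff, creationCoeff, annihilationCoeff,
      annihilationCoeff, neg_sub a.2 b.2, ← h1, ← h2, show q ^ (n : ℕ) = Q from rfl]
    field_simp
    ring
  rw [modeExponent, sum_mul_sum_eq_pairSum, hdiag, hsq, hpair]
  field_simp
  ring

/-- The insertion points are radially ordered and their ratios stay between `1` and `|q|⁻¹`. -/
def RadiallyOrdered (q : ℂ) (L : List (ℂ × ℂ)) : Prop :=
  L.Pairwise fun a b => 0 < (a.2 - b.2).re ∧ ‖q‖ * Real.exp (a.2 - b.2).re < 1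

lemma summable_pow_div_one_sub {q : ℂ} (hq : ‖q‖ < 1) :
    Summable fun n : ℕ+ => q ^ (n : ℕ) / (1 - q ^ (n : ℕ)) := by
  have hpos : 0 < 1 - ‖q‖ := by linarith
  refine Summable.of_norm_bounded
    ((summable_pnat_geometric (norm_nonneg q) hq).mul_left (1 - ‖q‖)⁻¹) fun n => ?_
  have := norm_one_sub_pow_ge hq n
  rw [norm_div, norm_pow, div_eq_inv_mul]
  gcongr

lemma hasSum_pairSum_contractionTerm {q : ℂ} (hq : ‖q‖ < 1) {L : List (ℂ × ℂ)}
    (hL : RadiallyOrdered q L) :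
    HasSum (fun n : ℕ+ => pairSum (fun a b => a.1 * b.1 * contractionTerm q n (a.2 - b.2)) L)
      (pairSum (fun a b => a.1 * b.1 *
        (Complex.log (1 - Complex.exp (-(a.2 - b.2))) + winding q (a.2 - b.2))) L) :=
  hasSum_pairSum (hL.imp fun h => (hasSum_contractionTerm hq h.1 h.2).mul_left _)

lemma summable_modeExponent {q : ℂ} (hq : ‖q‖ < 1) {L : List (ℂ × ℂ)}
    (hL : RadiallyOrdered q L) :
    Summable fun n : ℕ+ =>
      modeExponent (creationCoeff n) (annihilationCoeff n) L (q ^ (n : ℕ)) := by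
  simp_rw [modeExponent_eq hq]
  refine (hasSum_pairSum_contractionTerm hq hL).summable.sub (Summable.mul_left _ ?_)
  refine Summable.of_norm_bounded (summable_pow_div_one_sub hq).norm fun n => ?_
  rw [norm_div _ ((n : ℕ) : ℂ), Complex.norm_natCast]
  exact div_le_self (norm_nonneg _) (by exact_mod_cast one_le)

/-- Replacing charges and insertion points by `|β|` and `Re z` replaces the coefficients of the
vertex operators by their absolute values, up to a common sign. -/
noncomputable def absInsertion (a : ℂ × ℂ) : ℂ × ℂ := (((‖a.1‖ : ℝ) : ℂ), ((a.2.re : ℝ) : ℂ))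

lemma RadiallyOrdered.map_absInsertion {q : ℂ} {L : List (ℂ × ℂ)} (hL : RadiallyOrdered q L) :
    RadiallyOrdered ((‖q‖ : ℝ) : ℂ) (L.map absInsertion) := by
  refine List.pairwise_map.2 (hL.imp fun h => ?_)
  simpa [absInsertion] using h

lemma modeExponent_norm (q : ℂ) (n : ℕ+) (L : List (ℂ × ℂ)) :
    modeExponent (fun a => ((‖creationCoeff n a‖ : ℝ) : ℂ))
      (fun a => ((‖annihilationCoeff n a‖ : ℝ) : ℂ)) L ((‖q ^ (n : ℕ)‖ : ℝ) : ℂ) =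
    -modeExponent (creationCoeff n) (annihilationCoeff n) (L.map absInsertion)
      (((‖q‖ : ℝ) : ℂ) ^ (n : ℕ)) := by
  have h1 : ∀ a, ((‖creationCoeff n a‖ : ℝ) : ℂ) = creationCoeff n (absInsertion a) := fun a => by
    simp [creationCoeff, absInsertion, Complex.norm_exp]
  have h2 : ∀ a, ((‖annihilationCoeff n a‖ : ℝ) : ℂ) =
      (-1) * annihilationCoeff n (absInsertion a) := fun a => by
    simp [annihilationCoeff, absInsertion, Complex.norm_exp]
  simp only [modeExponent, h1, h2, pairSum_map, List.map_map, mul_assoc, pairSum_mul_left,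
    List.sum_map_mul_left, norm_pow]
  push_cast
  simp only [Function.comp_def]
  ring

end Propagator

/-! ### Evaluation of the torus intertwining functions of charged vectors -/

section TorusFunction

lemma inv_one_sub_le_exp {x : ℝ} (h1 : x < 1) : (1 - x)⁻¹ ≤ Real.exp (x / (1 - x)) := by
  have hpos : 0 < 1 - x := by linarith
  calc (1 - x)⁻¹ = x / (1 - x) + 1 := by field_simp; ring
    _ ≤ Real.exp (x / (1 - x)) := Real.add_one_le_exp _

lemma norm_pow_lt_one {q : ℂ} (hq : ‖q‖ < 1) (n : ℕ+) : ‖q ^ (n : ℕ)‖ < 1 := by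
  rw [norm_pow]
  exact pow_lt_one₀ (norm_nonneg _) hq n.ne_zero

lemma tsum_norm_modeDiag_le {q : ℂ} (hq : ‖q‖ < 1) (n : ℕ+) (L : List (ℂ × ℂ)) :
    ∑' x, ‖modeDiag (creationCoeff n) (annihilationCoeff n) L (q ^ (n : ℕ)) x‖ ≤
      Real.exp (‖q‖ ^ (n : ℕ) / (1 - ‖q‖ ^ (n : ℕ)) +
        ‖modeExponent (creationCoeff n) (annihilationCoeff n) (L.map absInsertion)
          (((‖q‖ : ℝ) : ℂ) ^ (n : ℕ))‖) := by
  have hQ := norm_pow_lt_one hq n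
  have h := hasSum_modeDiag (fun a => ((‖creationCoeff n a‖ : ℝ) : ℂ))
    (fun a => ((‖annihilationCoeff n a‖ : ℝ) : ℂ)) L (Q := ((‖q ^ (n : ℕ)‖ : ℝ) : ℂ))
    (by simpa using hQ)
  have h2 : ((∑' x, ‖modeDiag (creationCoeff n) (annihilationCoeff n) L (q ^ (n : ℕ)) x‖ : ℝ) : ℂ) =
      (1 - ((‖q ^ (n : ℕ)‖ : ℝ) : ℂ))⁻¹ * Complex.exp
        (-modeExponent (creationCoeff n) (annihilationCoeff n) (L.map absInsertion)
          (((‖q‖ : ℝ) : ℂ) ^ (n : ℕ))) := by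
    rw [Complex.ofReal_tsum, ← modeExponent_norm, ← h.tsum_eq]
    exact tsum_congr fun x => norm_modeDiag _ _ _ _ _
  have h3 := congrArg norm h2
  rw [Complex.norm_real, Real.norm_of_nonneg (tsum_nonneg fun _ => norm_nonneg _), norm_mul] at h3
  rw [h3, Real.exp_add]
  have h4 : ‖(1 - ((‖q ^ (n : ℕ)‖ : ℝ) : ℂ))⁻¹‖ = (1 - ‖q‖ ^ (n : ℕ))⁻¹ := by
    rw [← Complex.ofReal_one, ← Complex.ofReal_sub, norm_inv, Complex.norm_real,
      Real.norm_of_nonneg (by linarith), norm_pow]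
  rw [h4]
  gcongr
  · exact inv_one_sub_le_exp (by rwa [← norm_pow])
  · exact (Complex.norm_exp_le_exp_norm _).trans_eq (by rw [norm_neg])

/-- The trace of `q^{∑ a(-n) a(n)}` over the Fock space. -/
noncomputable def fockVacuum (q : ℂ) : ℂ := ∏' n : ℕ+, (1 - q ^ (n : ℕ))⁻¹

lemma hasProd_fockVacuum {q : ℂ} (hq : ‖q‖ < 1) :
    HasProd (fun n : ℕ+ => (1 - q ^ (n : ℕ))⁻¹) (fockVacuum q) := by
  refine Multipliable.hasProd ?_
  have h := multipliable_one_add_of_summable (summable_pow_div_one_sub hq).norm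
  refine h.congr fun n => ?_
  have := one_sub_pow_ne_zero hq n
  field_simp
  ring

/-- The trace over the Fock space of the oscillator parts of the vertex operators. -/
theorem hasSum_fockDiag {q : ℂ} (hq : ‖q‖ < 1) {L : List (ℂ × ℂ)} (hL : RadiallyOrdered q L)
    (hcharge : chargeSum L = 0) :
    HasSum (fockDiag L q) (fockVacuum q * Complex.exp (pairSum (fun a b => a.1 * b.1 *
      (Complex.log (1 - Complex.exp (-(a.2 - b.2))) + winding q (a.2 - b.2))) L)) := by
  have hq' : ‖((‖q‖ : ℝ) : ℂ)‖ < 1 := by simpa using hq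
  have hsum1 : Summable fun n : ℕ+ => ‖q‖ ^ (n : ℕ) / (1 - ‖q‖ ^ (n : ℕ)) := by
    have := summable_pow_div_one_sub hq'
    exact_mod_cast this
  have hsum2 := (summable_modeExponent hq' hL.map_absInsertion).norm
  obtain ⟨h1, h2⟩ := summable_and_tendsto_finsupp_prod
    (fun (n : ℕ+) x => modeDiag (creationCoeff n) (annihilationCoeff n) L (q ^ (n : ℕ)) x)
    (fun n => (1 - q ^ (n : ℕ))⁻¹ *
      Complex.exp (modeExponent (creationCoeff n) (annihilationCoeff n) L (q ^ (n : ℕ))))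
    (fun n => ∑' x, ‖modeDiag (creationCoeff n) (annihilationCoeff n) L (q ^ (n : ℕ)) x‖)
    (fun n => modeDiag_zero _ _ _ _)
    (fun n => hasSum_modeDiag _ _ L (norm_pow_lt_one hq n))
    (fun n => (hasSum_modeDiag _ _ L (norm_pow_lt_one hq n)).summable.norm.hasSum)
    (Real.exp (∑' n : ℕ+, (‖q‖ ^ (n : ℕ) / (1 - ‖q‖ ^ (n : ℕ)) +
        ‖modeExponent (creationCoeff n) (annihilationCoeff n) (L.map absInsertion)
          (((‖q‖ : ℝ) : ℂ) ^ (n : ℕ))‖)))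
    (fun s => by
      refine (Finset.prod_le_prod (fun n _ => tsum_nonneg fun _ => norm_nonneg _)
        fun n _ => tsum_norm_modeDiag_le hq n L).trans ?_
      rw [← Real.exp_sum]
      refine Real.exp_le_exp.2 ((hsum1.add hsum2).sum_le_tsum s fun n _ => ?_)
      have : ‖q‖ ^ (n : ℕ) < 1 := by simpa using norm_pow_lt_one hq n
      exact add_nonneg (div_nonneg (by positivity) (by linarith)) (norm_nonneg _))
  rw [← (occupationEquiv L.length).hasSum_iff]
  have h3 : fockDiag L q ∘ occupationEquiv L.length = fun f => f.prod fun n x =>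
      modeDiag (creationCoeff n) (annihilationCoeff n) L (q ^ (n : ℕ)) x :=
    funext fun f => fockDiag_occupationEquiv L q f
  rw [h3]
  have h4 : Tendsto (fun s : Finset ℕ+ => ∏ n ∈ s, ((1 - q ^ (n : ℕ))⁻¹ *
      Complex.exp (modeExponent (creationCoeff n) (annihilationCoeff n) L (q ^ (n : ℕ))))) atTop
      (𝓝 (fockVacuum q * Complex.exp (pairSum (fun a b => a.1 * b.1 *
        (Complex.log (1 - Complex.exp (-(a.2 - b.2))) + winding q (a.2 - b.2))) L))) := by
    simp_rw [Finset.prod_mul_distrib, ← Complex.exp_sum]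
    refine Tendsto.mul (hasProd_fockVacuum hq) ?_
    refine (Complex.continuous_exp.tendsto _).comp ?_
    have h5 := hasSum_pairSum_contractionTerm hq hL
    refine Tendsto.congr (fun s => ?_) h5
    refine Finset.sum_congr rfl fun n _ => ?_
    rw [modeExponent_eq hq, hcharge]
    ring
  rw [tendsto_nhds_unique h4 h2]
  exact h1.hasSum

lemma zeroModeAmp_eq {L : List (ℂ × ℂ)} (hcharge : chargeSum L = 0) (μ : ℂ) :
    zeroModeAmp L μ = Complex.exp (μ * (L.map fun a => a.1 * a.2).sum +
      pairSum (fun a b => a.1 * b.1 * ((a.2 - b.2) / 2)) L) := by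
  have h1 : ∀ L : List (ℂ × ℂ), zeroModeAmp L μ = Complex.exp
      (μ * (L.map fun a => a.1 * a.2).sum + (1 / 2) * (L.map fun a => a.1 * a.2 * a.1).sum +
        pairSum (fun a b => a.1 * a.2 * b.1) L) := by
    intro L
    induction L with
    | nil => simp [zeroModeAmp, pairSum]
    | cons a L ih =>
      rw [zeroModeAmp, ih, ← Complex.exp_add]
      congr 1
      simp only [pairSum, List.map_cons, List.sum_cons, List.sum_map_mul_left, weight,
        Finsupp.sum_zero_index, chargeSum]
      ring
  rw [h1]
  congr 1
  have h2 := sum_mul_sum_eq_pairSum (fun a : ℂ × ℂ => a.1 * a.2) Prod.fst L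
  rw [show (L.map Prod.fst).sum = 0 from hcharge, mul_zero] at h2
  have h3 : pairSum (fun a b : ℂ × ℂ => a.1 * b.1 * ((a.2 - b.2) / 2)) L =
      pairSum (fun a b => a.1 * a.2 * b.1) L +
        (-1 / 2) * pairSum (fun a b => a.1 * a.2 * b.1 + b.1 * b.2 * a.1) L := by
    rw [← pairSum_mul_left, ← pairSum_add]
    congr 1
    funext a b
    ring
  rw [h3]
  linear_combination (-1 / 2) * h2

/-- The nome `q = e^{2πiτ}`. -/
noncomputable def nome (τ : UpperHalfPlane) : ℂ := Complex.exp (2 * Real.pi * Complex.I * (τ : ℂ))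

lemma norm_nome (τ : UpperHalfPlane) : ‖nome τ‖ = Real.exp (-(2 * Real.pi * τ.im)) := by
  rw [nome, Complex.norm_exp]
  congr 1
  simp [mul_assoc]

lemma norm_nome_lt_one (τ : UpperHalfPlane) : ‖nome τ‖ < 1 := by
  rw [norm_nome]
  exact Real.exp_lt_one_iff.2 (by have := τ.im_pos; have := Real.pi_pos; simp; positivity)

lemma norm_nome_mul_exp_lt_one {τ : UpperHalfPlane} {x : ℝ} (h : x < 2 * Real.pi * τ.im) :
    ‖nome τ‖ * Real.exp x < 1 := by
  rw [norm_nome, ← Real.exp_add]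
  exact Real.exp_lt_one_iff.2 (by linarith)

/-- The terms of the theta series. -/
noncomputable def thetaTerm (α β : ℝ) (z : ℂ) (τ : UpperHalfPlane) (n : ℤ) : ℂ :=
  Complex.exp (Real.pi * Complex.I * ((n : ℂ) + (α : ℂ)) ^ 2 * (τ : ℂ) +
    ((n : ℂ) + (α : ℂ)) * (z + 2 * Real.pi * Complex.I * (β : ℂ)))

lemma thetaTerm_eq_jacobi (α β : ℝ) (z : ℂ) (τ : UpperHalfPlane) (n : ℤ) :
    thetaTerm α β z τ n = Complex.exp (Real.pi * Complex.I * (α : ℂ) ^ 2 * (τ : ℂ) +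
      (α : ℂ) * (z + 2 * Real.pi * Complex.I * (β : ℂ))) *
      jacobiTheta₂_term n (z / (2 * Real.pi * Complex.I) + (β + α * (τ : ℂ))) τ := by
  have hpi : (Real.pi : ℂ) ≠ 0 := by exact_mod_cast Real.pi_ne_zero
  rw [thetaTerm, jacobiTheta₂_term, ← Complex.exp_add]
  congr 1
  field_simp [Complex.I_ne_zero]
  ring

lemma hasSum_thetaTerm (α β : ℝ) (z : ℂ) (τ : UpperHalfPlane) :
    HasSum (thetaTerm α β z τ) (theta α β z τ) := by
  have h : Summable (thetaTerm α β z τ) := by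
    refine Summable.congr (Summable.mul_left (Complex.exp (Real.pi * Complex.I * (α : ℂ) ^ 2 *
      (τ : ℂ) + (α : ℂ) * (z + 2 * Real.pi * Complex.I * (β : ℂ))))
      ((summable_jacobiTheta₂_term_iff (z / (2 * Real.pi * Complex.I) + (β + α * (τ : ℂ))) τ).2
        τ.im_pos)) fun n => ?_
    rw [thetaTerm_eq_jacobi]
  exact h.hasSum

lemma weight_eq (μ : ℂ) (l : ℕ+ →₀ ℕ) : weight μ l = (multiDeg l : ℂ) + μ ^ 2 / 2 := by
  rw [weight, multiDeg, Finsupp.sum, Finsupp.sum]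
  push_cast
  rfl

open Classical in
lemma traceTerm_eq (α β : ℝ) (τ : UpperHalfPlane) {L : List (ℂ × ℂ)} (hcharge : chargeSum L = 0)
    (b : ℤ × (ℕ+ →₀ ℕ) × (Fin L.length → ℕ × ℕ)) :
    traceTerm α β τ L b = thetaTerm α β (L.map fun a => a.1 * a.2).sum τ b.1 *
      (Complex.exp (-(2 * Real.pi * Complex.I * (τ : ℂ) / 24) +
          pairSum (fun a b => a.1 * b.1 * ((a.2 - b.2) / 2)) L) *
        ∑ x ∈ ({b.2.1} : Finset (ℕ+ →₀ ℕ)) ×ˢ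
            Fintype.piFinset fun i => multiIdx (b.2.2 i).1 ×ˢ multiIdx (b.2.2 i).2,
          fockDiag L (nome τ) x) := by
  obtain ⟨m, l, p⟩ := b
  rw [traceTerm]
  simp only
  rw [Module.End.mul_apply, prod_vertexTerm_basisVec, map_sum, Finsupp.finsetSum_apply,
    MvPolynomial.coeff_sum, Finset.sum_product, Finset.sum_singleton, Finset.sum_mul,
    Finset.mul_sum, Finset.mul_sum]
  refine Finset.sum_congr rfl fun P _ => ?_
  rw [map_smul, hcharge, add_zero, expChargeOp_basisVec, smul_smul, smul_basisVec,
    Finsupp.single_eq_same, MvPolynomial.coeff_monomial, fockDiag]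
  simp only
  by_cases h : fockOut L P l = l
  · rw [if_pos h, if_pos h, zeroModeAmp_eq hcharge, thetaTerm, weight_eq, nome,
      ← Complex.exp_nat_mul]
    set S := pairSum (fun a b : ℂ × ℂ => a.1 * b.1 * ((a.2 - b.2) / 2)) L
    set W := (L.map fun a : ℂ × ℂ => a.1 * a.2).sum
    set F := fockAmp L P l
    have e : ∀ x y z u v w : ℂ, x + y + z = u + v + w →
        Complex.exp x * F * Complex.exp y * Complex.exp z =
          Complex.exp u * (Complex.exp v * (F * Complex.exp w)) := by
      intro x y z u v w h
      have h' := congrArg Complex.exp h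
      simp only [Complex.exp_add] at h'
      linear_combination F * h'
    refine e _ _ _ _ _ _ ?_
    ring
  · rw [if_neg h, if_neg h]
    simp

/-- The factor of the intertwining functions that depends on `τ` only, i.e. `1 / η(τ)`. -/
noncomputable def vacuumFactor (τ : UpperHalfPlane) : ℂ :=
  Complex.exp (-(2 * Real.pi * Complex.I * (τ : ℂ) / 24)) * fockVacuum (nome τ)

/-- The torus intertwining function of charged vectors of total charge zero is a theta function
times the exponential of the pairwise interactions. -/
theorem hasSum_traceTerm (α β : ℝ) (τ : UpperHalfPlane) {L : List (ℂ × ℂ)}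
    (hcharge : chargeSum L = 0) (hL : RadiallyOrdered (nome τ) L) :
    HasSum (traceTerm α β τ L) (vacuumFactor τ * theta α β (L.map fun a => a.1 * a.2).sum τ *
      Complex.exp (pairSum (fun a b => a.1 * b.1 * logPrime (nome τ) (a.2 - b.2)) L)) := by
  classical
  have h1 := hasSum_of_fiber_finset (hasSum_fockDiag (norm_nome_lt_one τ) hL hcharge)
    (P := (ℕ+ →₀ ℕ) × (Fin L.length → ℕ × ℕ))
    (fun x => (x.1, fun i => (multiDeg (x.2 i).1, multiDeg (x.2 i).2)))
    (fun y => ({y.1} : Finset (ℕ+ →₀ ℕ)) ×ˢ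
      Fintype.piFinset fun i => multiIdx (y.2 i).1 ×ˢ multiIdx (y.2 i).2) (by
      rintro ⟨l, p⟩ ⟨N, P⟩
      simp only [Finset.mem_product, Finset.mem_singleton, Fintype.mem_piFinset, mem_multiIdx,
        funext_iff, Prod.ext_iff])
  have h2 := hasSum_mul_prod (hasSum_thetaTerm α β (L.map fun a => a.1 * a.2).sum τ)
    (h1.mul_left (Complex.exp (-(2 * Real.pi * Complex.I * (τ : ℂ) / 24) +
          pairSum (fun a b => a.1 * b.1 * ((a.2 - b.2) / 2)) L)))
  have h3 : pairSum (fun a b : ℂ × ℂ => a.1 * b.1 * logPrime (nome τ) (a.2 - b.2)) L =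
      pairSum (fun a b => a.1 * b.1 * ((a.2 - b.2) / 2)) L + pairSum (fun a b => a.1 * b.1 *
        (Complex.log (1 - Complex.exp (-(a.2 - b.2))) + winding (nome τ) (a.2 - b.2))) L := by
    rw [← pairSum_add]
    congr 1
    funext a b
    rw [logPrime]
    ring
  convert! h2 using 1
  · exact funext fun b => traceTerm_eq α β τ hcharge b
  · rw [h3, vacuumFactor, Complex.exp_add, Complex.exp_add]
    ring

end TorusFunction

/-! ### The Jacobi triple product -/

section TripleProduct

/-- The Gaussian binomial coefficients. -/
def gaussBinom (q : ℂ) : ℕ → ℕ → ℂ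
  | _, 0 => 1
  | 0, _ + 1 => 0
  | M + 1, k + 1 => gaussBinom q M k + q ^ (k + 1) * gaussBinom q M (k + 1)

/-- The product `(1 - q) (1 - q^2) ⋯ (1 - q^n)`. -/
def qFactorial (q : ℂ) (n : ℕ) : ℂ := ∏ i ∈ Finset.range n, (1 - q ^ (i + 1))

lemma gaussBinom_eq_zero (q : ℂ) {M k : ℕ} (h : M < k) : gaussBinom q M k = 0 := by
  induction M generalizing k with
  | zero =>
    cases k with
    | zero => omega
    | succ k => rfl
  | succ M ih =>
    cases k with
    | zero => omega
    | succ k => rw [gaussBinom, ih (by omega), ih (by omega)]; ring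

lemma gaussBinom_zero_right (q : ℂ) (M : ℕ) : gaussBinom q M 0 = 1 := by
  cases M <;> rfl

lemma gaussBinom_mul_qFactorial (q : ℂ) (M a b : ℕ) (h : a + b = M) :
    gaussBinom q M a * qFactorial q a * qFactorial q b = qFactorial q M := by
  induction M generalizing a b with
  | zero =>
    obtain ⟨rfl, rfl⟩ : a = 0 ∧ b = 0 := by omega
    simp [gaussBinom, qFactorial]
  | succ M ih =>
    rcases a with _ | a
    · obtain rfl : b = M + 1 := by omega
      simp [gaussBinom, qFactorial]
    have h1 := ih a b (by omega)
    have hs : ∀ n, qFactorial q (n + 1) = qFactorial q n * (1 - q ^ (n + 1)) := fun n =>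
      Finset.prod_range_succ _ _
    rw [gaussBinom, hs M, ← h1, hs a]
    rcases b with _ | b
    · obtain rfl : a = M := by omega
      rw [gaussBinom_eq_zero q (Nat.lt_succ_self a)]
      ring
    · have h2 := ih (a + 1) b (by omega)
      rw [hs a] at h2
      have h3 : q ^ (M + 1) = q ^ (a + 1) * q ^ (b + 1) := by rw [← pow_add]; congr 1; omega
      rw [hs b] at h1 ⊢
      rw [h3]
      linear_combination q ^ (a + 1) * (1 - q ^ (b + 1)) * (h2 - h1)

lemma prod_one_add_pow_mul (q t : ℂ) (M : ℕ) :
    ∏ j ∈ Finset.range M, (1 + q ^ j * t) =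
      ∑ k ∈ Finset.range (M + 1), gaussBinom q M k * (q ^ k.choose 2 * t ^ k) := by
  induction M generalizing t with
  | zero => simp [gaussBinom]
  | succ M ih =>
    rw [Finset.prod_range_succ']
    have h1 : ∏ j ∈ Finset.range M, (1 + q ^ (j + 1) * t) =
        ∏ j ∈ Finset.range M, (1 + q ^ j * (q * t)) :=
      Finset.prod_congr rfl fun j _ => by ring
    have hc : ∀ k : ℕ, (k + 1).choose 2 = k + k.choose 2 := fun k => by
      rw [Nat.choose_succ_succ' k 1, Nat.choose_one_right]
    rw [h1, ih, pow_zero, one_mul, mul_add, mul_one, Finset.sum_range_succ' _ (M + 1)]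
    have h2 : ∑ k ∈ Finset.range (M + 1), gaussBinom q (M + 1) (k + 1) *
          (q ^ (k + 1).choose 2 * t ^ (k + 1)) =
        ∑ k ∈ Finset.range (M + 1), gaussBinom q M k * (q ^ k.choose 2 * (q * t) ^ k) * t +
        ∑ k ∈ Finset.range (M + 1), gaussBinom q M (k + 1) *
          (q ^ (k + 1).choose 2 * (q * t) ^ (k + 1)) := by
      rw [← Finset.sum_add_distrib]
      refine Finset.sum_congr rfl fun k _ => ?_
      rw [gaussBinom, hc, pow_add, mul_pow, mul_pow, pow_succ t]
      ring
    have h3 := Finset.sum_range_succ' (fun k => gaussBinom q M k *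
      (q ^ k.choose 2 * (q * t) ^ k)) (M + 1)
    rw [Finset.sum_range_succ, gaussBinom_eq_zero q (Nat.lt_succ_self M), zero_mul, add_zero] at h3
    rw [gaussBinom_zero_right, pow_zero] at h3
    rw [h2, ← Finset.sum_mul, gaussBinom_zero_right, pow_zero]
    linear_combination h3

/-- The finite form of the Jacobi triple product. -/
lemma sum_gaussBinom_mul_thetaTerm (τ : UpperHalfPlane) (z : ℂ) (N : ℕ) :
    ∑ k ∈ Finset.range (2 * N + 1), gaussBinom (nome τ) (2 * N) k *
        thetaTerm (1 / 2) (1 / 2) z τ ((k : ℤ) - N - 1) =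
      Complex.exp (Real.pi * Complex.I * (τ : ℂ) / 4 - (z + Real.pi * Complex.I) / 2) *
        ((∏ i ∈ Finset.range N, (1 - nome τ ^ (i + 1) * Complex.exp (-z))) *
          ∏ i ∈ Finset.range N, (1 - nome τ ^ i * Complex.exp z)) := by
  have hpow : ∀ n : ℕ, nome τ ^ n = Complex.exp (n * (2 * Real.pi * Complex.I * (τ : ℂ))) :=
    fun n => (Complex.exp_nat_mul _ n).symm
  have hpi : Complex.exp (Real.pi * Complex.I) = -1 := Complex.exp_pi_mul_I
  set t := Complex.exp (z + Real.pi * Complex.I - N * (2 * Real.pi * Complex.I * (τ : ℂ))) with ht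
  have hterm : ∀ k : ℕ, thetaTerm (1 / 2) (1 / 2) z τ ((k : ℤ) - N - 1) =
      Complex.exp (Real.pi * Complex.I * (τ : ℂ) * (N + 1 / 2) ^ 2 -
        (N + 1 / 2) * (z + Real.pi * Complex.I)) * (nome τ ^ k.choose 2 * t ^ k) := by
    intro k
    rw [thetaTerm, hpow, ht, ← Complex.exp_nat_mul, ← Complex.exp_add, ← Complex.exp_add]
    congr 1
    rw [Nat.cast_choose_two]
    push_cast
    ring
  have hlow : ∀ i ∈ Finset.range N, 1 + nome τ ^ (N - 1 - i) * t =
      Complex.exp (z + Real.pi * Complex.I - (i + 1) * (2 * Real.pi * Complex.I * (τ : ℂ))) *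
        (1 - nome τ ^ (i + 1) * Complex.exp (-z)) := by
    intro i hi
    have hi := Finset.mem_range.1 hi
    have h1 : nome τ ^ (N - 1 - i) * t =
        Complex.exp (z + Real.pi * Complex.I - (i + 1) * (2 * Real.pi * Complex.I * (τ : ℂ))) := by
      rw [hpow, ht, ← Complex.exp_add, Nat.cast_sub (by omega), Nat.cast_sub (by omega)]
      congr 1
      push_cast
      ring
    have h2 : Complex.exp (z + Real.pi * Complex.I -
        (i + 1) * (2 * Real.pi * Complex.I * (τ : ℂ))) *
        (nome τ ^ (i + 1) * Complex.exp (-z)) = -1 := by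
      rw [hpow, ← Complex.exp_add, ← Complex.exp_add, ← hpi]
      congr 1
      push_cast
      ring
    rw [h1, mul_sub, h2]
    ring
  have hhigh : ∀ i, 1 + nome τ ^ (N + i) * t = 1 - nome τ ^ i * Complex.exp z := by
    intro i
    have h1 : nome τ ^ (N + i) * t =
        nome τ ^ i * Complex.exp z * Complex.exp (Real.pi * Complex.I) := by
      rw [hpow, hpow, ht, ← Complex.exp_add, ← Complex.exp_add, ← Complex.exp_add]
      congr 1
      push_cast
      ring
    rw [h1, hpi]
    ring
  have hpre : ∏ i ∈ Finset.range N,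
      Complex.exp (z + Real.pi * Complex.I - (i + 1) * (2 * Real.pi * Complex.I * (τ : ℂ))) =
      Complex.exp (N * (z + Real.pi * Complex.I) -
        Real.pi * Complex.I * (τ : ℂ) * (N * (N + 1))) := by
    clear_value t
    clear hterm hlow hhigh ht
    induction N with
    | zero => simp
    | succ N ih =>
      rw [Finset.prod_range_succ, ih, ← Complex.exp_add]
      congr 1
      push_cast
      ring
  simp_rw [hterm, mul_left_comm _ (Complex.exp (Real.pi * Complex.I * (τ : ℂ) * (N + 1 / 2) ^ 2 -
    (N + 1 / 2) * (z + Real.pi * Complex.I)))]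
  rw [← Finset.mul_sum, ← prod_one_add_pow_mul, two_mul, Finset.prod_range_add,
    ← Finset.prod_range_reflect, Finset.prod_congr rfl hlow,
    Finset.prod_congr rfl fun i _ => hhigh i,
    Finset.prod_mul_distrib, hpre]
  have he : Complex.exp (Real.pi * Complex.I * (τ : ℂ) * (N + 1 / 2) ^ 2 -
        (N + 1 / 2) * (z + Real.pi * Complex.I)) *
      Complex.exp (N * (z + Real.pi * Complex.I) - Real.pi * Complex.I * (τ : ℂ) * (N * (N + 1))) =
      Complex.exp (Real.pi * Complex.I * (τ : ℂ) / 4 - (z + Real.pi * Complex.I) / 2) := by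
    rw [← Complex.exp_add]
    congr 1
    ring
  rw [← he]
  ring

lemma qFactorial_ne_zero {q : ℂ} (hq : ‖q‖ < 1) (n : ℕ) : qFactorial q n ≠ 0 :=
  Finset.prod_ne_zero_iff.2 fun i _ => one_sub_pow_ne_zero hq i.succPNat

lemma exists_tendsto_qFactorial {q : ℂ} (hq : ‖q‖ < 1) :
    ∃ Q : ℂ, Q ≠ 0 ∧ Tendsto (qFactorial q) atTop (𝓝 Q) := by
  refine ⟨∏' n, (1 - q ^ (n + 1)), ?_,
    (ModularForm.multipliable_one_sub_pow hq).hasProd.tendsto_prod_nat⟩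
  have h : Summable fun n : ℕ => ‖-q ^ (n + 1)‖ := by
    simpa using (summable_nat_add_iff 1).mpr (summable_geometric_of_lt_one (norm_nonneg _) hq)
  simpa [sub_eq_add_neg] using tprod_one_add_ne_zero_of_summable (f := fun n => -q ^ (n + 1))
    (fun n => by
      have := one_sub_pow_ne_zero hq n.succPNat
      simpa [sub_eq_add_neg] using this) h

/-- The Jacobi triple product, up to a constant. -/
lemma exists_tendsto_prod_theta1 (τ : UpperHalfPlane) :
    ∃ c : ℂ, c ≠ 0 ∧ ∀ z, Tendsto (fun N : ℕ => c * Complex.exp (-z / 2) *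
      ((∏ i ∈ Finset.range N, (1 - nome τ ^ (i + 1) * Complex.exp (-z))) *
          ∏ i ∈ Finset.range N, (1 - nome τ ^ i * Complex.exp z))) atTop (𝓝 (theta1 z τ)) := by
  have hq := norm_nome_lt_one τ
  obtain ⟨Q, hQ0, hQ⟩ := exists_tendsto_qFactorial hq
  obtain ⟨B, hB⟩ := hQ.norm.bddAbove_range
  obtain ⟨D, hD⟩ := (hQ.inv₀ hQ0).norm.bddAbove_range
  have hB' : ∀ n, ‖qFactorial (nome τ) n‖ ≤ B := fun n => hB ⟨n, rfl⟩
  have hD' : ∀ n, ‖(qFactorial (nome τ) n)⁻¹‖ ≤ D := fun n => hD ⟨n, rfl⟩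
  have hB0 : 0 ≤ B := (norm_nonneg _).trans (hB' 0)
  have hD0 : 0 ≤ D := (norm_nonneg _).trans (hD' 0)
  have hgb : ∀ {M a b : ℕ}, a + b = M → gaussBinom (nome τ) M a =
      qFactorial (nome τ) M * (qFactorial (nome τ) a)⁻¹ * (qFactorial (nome τ) b)⁻¹ := by
    intro M a b h
    rw [← gaussBinom_mul_qFactorial _ M a b h]
    field_simp [qFactorial_ne_zero hq a, qFactorial_ne_zero hq b]
  have hbound : ∀ M a, ‖gaussBinom (nome τ) M a‖ ≤ B * D * D := by
    intro M a
    rcases lt_or_ge M a with h | h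
    · rw [gaussBinom_eq_zero _ h, norm_zero]
      positivity
    · rw [hgb (Nat.add_sub_cancel' h), norm_mul, norm_mul]
      gcongr
      exacts [hB' _, hD' _, hD' _]
  refine ⟨Q * Complex.exp (Real.pi * Complex.I * (τ : ℂ) / 4 - Real.pi * Complex.I / 2),
    mul_ne_zero hQ0 (Complex.exp_ne_zero _), fun z => ?_⟩
  let f : ℕ → ℤ → ℂ := fun N m => if 0 ≤ m + N + 1 then
    gaussBinom (nome τ) (2 * N) (m + N + 1).toNat * thetaTerm (1 / 2) (1 / 2) z τ m else 0
  have hf : ∀ N, ∑' m, f N m = ∑ k ∈ Finset.range (2 * N + 1), gaussBinom (nome τ) (2 * N) k *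
        thetaTerm (1 / 2) (1 / 2) z τ ((k : ℤ) - N - 1) := by
    intro N
    have h1 : HasSum (fun k : ℕ => gaussBinom (nome τ) (2 * N) k *
        thetaTerm (1 / 2) (1 / 2) z τ ((k : ℤ) - N - 1)) _ :=
      hasSum_sum_of_ne_finset_zero (s := Finset.range (2 * N + 1)) fun k hk => by
        rw [gaussBinom_eq_zero _ (by simpa using hk), zero_mul]
    have hinj : Function.Injective fun k : ℕ => (k : ℤ) - N - 1 := fun a b h => by
      simpa using h
    refine ((hinj.hasSum_iff (f := f N) ?_).1 ?_).tsum_eq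
    · intro m hm
      refine if_neg fun h => hm ⟨(m + N + 1).toNat, ?_⟩
      simp only
      omega
    · refine h1.congr_fun fun k => ?_
      simp only [f, Function.comp_apply]
      rw [if_pos (by omega)]
      congr 2
      omega
  have hlim : Tendsto (fun N => ∑' m, f N m) atTop
      (𝓝 (∑' m, Q⁻¹ * thetaTerm (1 / 2) (1 / 2) z τ m)) := by
    refine tendsto_tsum_of_dominated_convergence (bound := fun m => B * D * D *
      ‖thetaTerm (1 / 2) (1 / 2) z τ m‖) ((hasSum_thetaTerm _ _ z τ).summable.norm.mul_left _)
      (fun m => ?_) (Eventually.of_forall fun N m => ?_)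
    · have ha : Tendsto (fun N : ℕ => (m + N + 1).toNat) atTop atTop := by
        refine tendsto_atTop.2 fun b => ?_
        filter_upwards [eventually_ge_atTop (b + m.natAbs)] with N hN
        omega
      have hb : Tendsto (fun N : ℕ => ((N : ℤ) - m - 1).toNat) atTop atTop := by
        refine tendsto_atTop.2 fun b => ?_
        filter_upwards [eventually_ge_atTop (b + m.natAbs + 1)] with N hN
        omega
      have h2 : Tendsto (fun N : ℕ => 2 * N) atTop atTop :=
        tendsto_atTop.2 fun b => by
          filter_upwards [eventually_ge_atTop b] with N hN
          omega
      have h3 := (((hQ.comp h2).mul ((hQ.comp ha).inv₀ hQ0)).mul ((hQ.comp hb).inv₀ hQ0)).mul_const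
        (thetaTerm (1 / 2) (1 / 2) z τ m)
      rw [mul_inv_cancel₀ hQ0, one_mul] at h3
      refine h3.congr' ?_
      filter_upwards [eventually_ge_atTop (m.natAbs + 1)] with N hN
      simp only [f, Function.comp_apply]
      rw [if_pos (by omega), hgb (a := (m + N + 1).toNat) (b := ((N : ℤ) - m - 1).toNat) (by omega)]
    · simp only [f]
      split_ifs
      · rw [norm_mul]
        gcongr
        exact hbound _ _
      · rw [norm_zero]
        positivity
  rw [((hasSum_thetaTerm _ _ z τ).mul_left Q⁻¹).tsum_eq] at hlim
  have h4 := hlim.const_mul Q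
  rw [mul_inv_cancel_left₀ hQ0] at h4
  refine h4.congr fun N => ?_
  rw [hf, sum_gaussBinom_mul_thetaTerm, ← mul_assoc Q, mul_assoc Q (Complex.exp _) (Complex.exp _),
    ← Complex.exp_add]
  congr 3
  ring

end TripleProduct

/-! ### The prime form and the logarithm of `ϑ₁` -/

section PrimeForm

lemma tendsto_prod_winding {q : ℂ} (hq : ‖q‖ < 1) {z : ℂ} (hz : ‖q‖ * Real.exp |z.re| < 1) :
    Tendsto (fun N : ℕ => ∏ i ∈ Finset.range N, ((1 - q ^ (i + 1) * Complex.exp z) *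
      (1 - q ^ (i + 1) * Complex.exp (-z)) / (1 - q ^ (i + 1)) ^ 2)) atTop
      (𝓝 (Complex.exp (winding q z))) := by
  have hq' : ‖((‖q‖ : ℝ) : ℂ)‖ < 1 := by simpa using hq
  have hE : 1 ≤ Real.exp |z.re| := Real.one_le_exp (abs_nonneg _)
  have hpow : ∀ i : ℕ, ‖q ^ (i + 1)‖ ≤ ‖q‖ := fun i => by
    rw [norm_pow]
    exact pow_le_of_le_one (norm_nonneg _) hq.le i.succ_ne_zero
  have hx1 : ∀ i : ℕ, ‖q ^ (i + 1)‖ < 1 := fun i => (hpow i).trans_lt hq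
  have hx2 : ∀ i : ℕ, ‖q ^ (i + 1) * Complex.exp z‖ < 1 := fun i => by
    rw [norm_mul, Complex.norm_exp]
    refine lt_of_le_of_lt ?_ hz
    gcongr
    exacts [hpow i, le_abs_self _]
  have hx3 : ∀ i : ℕ, ‖q ^ (i + 1) * Complex.exp (-z)‖ < 1 := fun i => by
    rw [norm_mul, Complex.norm_exp, Complex.neg_re]
    refine lt_of_le_of_lt ?_ hz
    gcongr
    exacts [hpow i, neg_le_abs _]
  have h1 : HasSum (fun x : ℕ+ × ℕ =>
      -(Complex.exp z ^ (x.1 : ℕ) + Complex.exp (-z) ^ (x.1 : ℕ) - 2) *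
      (q ^ (x.1 : ℕ) * (q ^ (x.1 : ℕ)) ^ x.2) / ((x.1 : ℕ) : ℂ)) (winding q z) := by
    have hgeo : ∀ n : ℕ+, HasSum (fun i : ℕ => -(Complex.exp z ^ (n : ℕ) +
        Complex.exp (-z) ^ (n : ℕ) - 2) * (q ^ (n : ℕ) * (q ^ (n : ℕ)) ^ i) / ((n : ℕ) : ℂ))
        (windingTerm q n z) := fun n => by
      have h := (((hasSum_geometric_of_norm_lt_one (norm_pow_lt_one hq n)).mul_left
        (q ^ (n : ℕ))).mul_left (-(Complex.exp z ^ (n : ℕ) +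
        Complex.exp (-z) ^ (n : ℕ) - 2))).div_const ((n : ℕ) : ℂ)
      convert! h using 1
      rw [windingTerm]
      ring
    refine hasSum_prod_of_fibers (N := fun n => ‖windingTerm ((‖q‖ : ℝ) : ℂ) n z‖) hgeo
      (fun n => ?_) (summable_windingTerm hq' (by simpa using hz)).norm
      (summable_windingTerm hq hz).hasSum
    have hr : ‖q‖ ^ (n : ℕ) < 1 := by simpa using norm_pow_lt_one hq n
    have h := (((hasSum_geometric_of_lt_one (by positivity) hr).mul_left
        (‖q‖ ^ (n : ℕ))).mul_left ‖Complex.exp z ^ (n : ℕ) +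
        Complex.exp (-z) ^ (n : ℕ) - 2‖).div_const ((n : ℕ) : ℝ)
    convert! h using 1
    · funext i
      rw [norm_div, norm_mul, norm_mul, norm_neg, norm_pow, norm_pow, norm_pow,
        Complex.norm_natCast]
    · have h4 : ‖1 - ((‖q‖ : ℝ) : ℂ) ^ (n : ℕ)‖ = 1 - ‖q‖ ^ (n : ℕ) := by
        rw [← Complex.ofReal_pow, ← Complex.ofReal_one, ← Complex.ofReal_sub, Complex.norm_real,
          Real.norm_of_nonneg (by linarith)]
      rw [windingTerm, norm_div, norm_div, norm_mul, norm_neg, Complex.norm_natCast, h4, norm_pow,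
        Complex.norm_real, norm_norm]
      ring
  have h2 := ((Equiv.prodComm ℕ ℕ+).hasSum_iff.2 h1).prod_fiberwise (g := fun i : ℕ =>
      Complex.log (1 - q ^ (i + 1) * Complex.exp z) +
      Complex.log (1 - q ^ (i + 1) * Complex.exp (-z)) - 2 * Complex.log (1 - q ^ (i + 1)))
    fun i => by
      have h := (((hasSum_pnat_pow_div (hx2 i)).add (hasSum_pnat_pow_div (hx3 i))).sub
        ((hasSum_pnat_pow_div (hx1 i)).mul_left 2)).neg
      convert! h using 1
      · funext n
        simp only [Function.comp_apply, Equiv.prodComm_apply, Prod.fst_swap, Prod.snd_swap]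
        rw [mul_pow, mul_pow, ← pow_succ', ← pow_mul, ← pow_mul, mul_comm (n : ℕ)]
        ring
      · ring
  refine ((Complex.continuous_exp.tendsto _).comp h2.tendsto_sum_nat).congr fun N => ?_
  rw [Function.comp_apply, Complex.exp_sum]
  refine Finset.prod_congr rfl fun i _ => ?_
  have hne : ∀ x : ℂ, ‖x‖ < 1 → 1 - x ≠ 0 := fun x hx h => by
    rw [← sub_eq_zero.1 h, norm_one] at hx
    exact lt_irrefl _ hx
  rw [Complex.exp_sub, Complex.exp_add, two_mul, Complex.exp_add, Complex.exp_log (hne _ (hx1 i)),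
    Complex.exp_log (hne _ (hx2 i)), Complex.exp_log (hne _ (hx3 i)), sq]

lemma continuousOn_winding {q : ℂ} (hq : ‖q‖ < 1) (s : ℝ) (hs : ‖q‖ * Real.exp s < 1) :
    ContinuousOn (winding q) {z | |z.re| ≤ s} := by
  refine continuousOn_tsum (fun n => ?_) ((summable_pnat_geometric (by positivity) hs).mul_left _)
    fun n z hz => norm_windingTerm_le hq hz n
  unfold windingTerm
  fun_prop

lemma continuousAt_winding (τ : UpperHalfPlane) {z : ℂ} (hz : |z.re| < 2 * Real.pi * τ.im) :
    ContinuousAt (winding (nome τ)) z := by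
  obtain ⟨s, h1, h2⟩ := exists_between hz
  refine (continuousOn_winding (norm_nome_lt_one τ) s (norm_nome_mul_exp_lt_one h2)).continuousAt ?_
  have : IsOpen {z : ℂ | |z.re| < s} :=
    isOpen_lt (continuous_abs.comp Complex.continuous_re) continuous_const
  exact mem_of_superset (this.mem_nhds h1) fun w hw =>
    show |w.re| ≤ s from (show |w.re| < s from hw).le

/-- The expression of `ϑ₁` through the mode series, on a strip around the imaginary axis. -/
lemma exists_theta1_eq (τ : UpperHalfPlane) : ∃ c : ℂ, c ≠ 0 ∧ ∀ z : ℂ,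
    |z.re| < 2 * Real.pi * τ.im → theta1 z τ =
      c * ((Complex.exp (z / 2) - Complex.exp (-z / 2)) * Complex.exp (winding (nome τ) z)) := by
  have hq := norm_nome_lt_one τ
  obtain ⟨c, hc, h⟩ := exists_tendsto_prod_theta1 τ
  obtain ⟨Q, hQ0, hQ⟩ := exists_tendsto_qFactorial hq
  refine ⟨-(c * Q ^ 2), neg_ne_zero.2 (mul_ne_zero hc (pow_ne_zero 2 hQ0)), fun z hz => ?_⟩
  have h1 := (tendsto_prod_winding hq (norm_nome_mul_exp_lt_one hz)).mul (hQ.pow 2)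
  -- the two products differ by the factors `i = 0` and `i = N`
  have h2 : Tendsto (fun N : ℕ => 1 - nome τ ^ N * Complex.exp z) atTop (𝓝 1) := by
    have := ((tendsto_pow_atTop_nhds_zero_of_norm_lt_one hq).mul_const (Complex.exp z)).const_sub 1
    simpa using this
  have h3 := (h z).mul h2
  have h4 := h1.const_mul (c * Complex.exp (-z / 2) * (1 - Complex.exp z))
  have h5 := tendsto_nhds_unique (h3.congr fun N => ?_) h4
  · rw [mul_one] at h5
    rw [h5]
    have : Complex.exp (-z / 2) * Complex.exp z = Complex.exp (z / 2) := by
      rw [← Complex.exp_add]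
      congr 1
      ring
    linear_combination (-(c * Complex.exp (winding (nome τ) z) * Q ^ 2)) * this
  · have h6 := (Finset.prod_range_succ (fun i => 1 - nome τ ^ i * Complex.exp z) N).symm.trans
      (Finset.prod_range_succ' (fun i => 1 - nome τ ^ i * Complex.exp z) N)
    rw [pow_zero, one_mul] at h6
    have h7 : (∏ i ∈ Finset.range N, ((1 - nome τ ^ (i + 1) * Complex.exp z) *
        (1 - nome τ ^ (i + 1) * Complex.exp (-z)) / (1 - nome τ ^ (i + 1)) ^ 2)) *
        qFactorial (nome τ) N ^ 2 = (∏ i ∈ Finset.range N, (1 - nome τ ^ (i + 1) * Complex.exp z)) *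
        ∏ i ∈ Finset.range N, (1 - nome τ ^ (i + 1) * Complex.exp (-z)) := by
      rw [qFactorial, ← Finset.prod_pow, ← Finset.prod_mul_distrib, ← Finset.prod_mul_distrib]
      refine Finset.prod_congr rfl fun i _ => ?_
      have := one_sub_pow_ne_zero hq i.succPNat
      rw [Nat.succPNat_coe, Nat.succ_eq_add_one] at this
      field_simp
    rw [h7, mul_assoc _ (_ * _) (_ - _), mul_assoc (Finset.prod _ _) _ (_ - _), h6]
    ring

lemma winding_zero (q : ℂ) : winding q 0 = 0 := by
  rw [winding, ← tsum_zero (β := ℕ+)]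
  congr 1
  funext n
  have h2 : (1 : ℂ) + 1 - 2 = 0 := by norm_num
  simp [windingTerm, h2]

/-- The prime form through the mode series; the normalisation `K(z) ∼ z` at the origin fixes the
constant. -/
lemma deriv_theta1_ne_zero_and_primeK_eq (τ : UpperHalfPlane) :
    deriv (fun u : ℂ => theta1 u τ) 0 ≠ 0 ∧ ∀ z : ℂ, |z.re| < 2 * Real.pi * τ.im →
      primeK z τ =
        (Complex.exp (z / 2) - Complex.exp (-z / 2)) * Complex.exp (winding (nome τ) z) := by
  obtain ⟨c, hc, h⟩ := exists_theta1_eq τ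
  have hpos : 0 < 2 * Real.pi * τ.im := by have := τ.im_pos; have := Real.pi_pos; positivity
  have hd : HasDerivAt (fun u : ℂ => theta1 u τ) c 0 := by
    have hU : {z : ℂ | |z.re| < 2 * Real.pi * τ.im} ∈ 𝓝 (0 : ℂ) := by
      refine (isOpen_lt (continuous_abs.comp Complex.continuous_re) continuous_const).mem_nhds ?_
      simpa using hpos
    have h0 : theta1 0 τ = 0 := by rw [h 0 (by simpa using hpos)]; simp
    have hu : HasDerivAt (fun z : ℂ => Complex.exp (z / 2) - Complex.exp (-z / 2)) 1 0 := by
      have h1 := ((hasDerivAt_id (0 : ℂ)).div_const 2).cexp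
      have h2 := ((hasDerivAt_id (0 : ℂ)).neg.div_const 2).cexp
      convert! h1.sub h2 using 1
      simp
      norm_num
    rw [hasDerivAt_iff_tendsto_slope] at hu ⊢
    have hv : Tendsto (fun z => Complex.exp (winding (nome τ) z)) (𝓝[≠] 0) (𝓝 1) := by
      have := (continuousAt_winding τ (z := 0) (by simpa using hpos)).cexp.tendsto
      rw [winding_zero, Complex.exp_zero] at this
      exact this.mono_left nhdsWithin_le_nhds
    have h3 := (hu.mul hv).const_mul c
    rw [mul_one, mul_one] at h3
    refine h3.congr' ?_
    filter_upwards [nhdsWithin_le_nhds hU] with z hz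
    rw [slope_def_field, slope_def_field, h z hz, h0]
    simp
    ring
  rw [hd.deriv]
  refine ⟨hc, fun z hz => ?_⟩
  rw [primeK, hd.deriv, h z hz, mul_div_cancel_left₀ _ hc]

lemma exp_logPrime {τ : UpperHalfPlane} {z : ℂ} (h0 : 0 < z.re) (hz : z.re < 2 * Real.pi * τ.im) :
    Complex.exp (logPrime (nome τ) z) = primeK z τ := by
  rw [(deriv_theta1_ne_zero_and_primeK_eq τ).2 z (by rwa [abs_of_pos h0]), logPrime,
    Complex.exp_add, Complex.exp_add]
  have hne : 1 - Complex.exp (-z) ≠ 0 := by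
    intro h
    have h1 := congrArg norm (sub_eq_zero.1 h)
    rw [norm_one, Complex.norm_exp, Complex.neg_re] at h1
    have := Real.exp_lt_one_iff.2 (show -z.re < 0 by linarith)
    linarith
  have h2 : Complex.exp (z / 2) * Complex.exp (-z) = Complex.exp (-z / 2) := by
    rw [← Complex.exp_add]
    congr 1
    ring
  rw [Complex.exp_log hne]
  linear_combination (-Complex.exp (winding (nome τ) z)) * h2

lemma primeK_ne_zero {τ : UpperHalfPlane} {z : ℂ} (h0 : 0 < z.re)
    (hz : z.re < 2 * Real.pi * τ.im) : primeK z τ ≠ 0 := by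
  rw [← exp_logPrime h0 hz]
  exact Complex.exp_ne_zero _

lemma continuousOn_logPrime (τ : UpperHalfPlane) :
    ContinuousOn (logPrime (nome τ)) {z : ℂ | 0 < z.re ∧ z.re < 2 * Real.pi * τ.im} := by
  intro z hz
  refine ContinuousAt.continuousWithinAt ?_
  have h1 := continuousAt_winding τ (z := z) (by rw [abs_of_pos hz.1]; exact hz.2)
  unfold logPrime
  refine ContinuousAt.add (ContinuousAt.add (by fun_prop) ?_) h1
  refine ContinuousAt.clog (by fun_prop) (Or.inl ?_)
  have h2 : ‖Complex.exp (-z)‖ < 1 := by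
    rw [Complex.norm_exp, Complex.neg_re]
    exact Real.exp_lt_one_iff.2 (by linarith [hz.1])
  have h3 := Complex.re_le_norm (Complex.exp (-z))
  rw [Complex.sub_re, Complex.one_re]
  linarith

lemma theta1_eq_exp {τ : UpperHalfPlane} {z : ℂ} (h0 : 0 < z.re)
    (hz : z.re < 2 * Real.pi * τ.im) :
    theta1 z τ = Complex.exp (Complex.log (deriv (fun u : ℂ => theta1 u τ) 0) +
      logPrime (nome τ) z) := by
  have hd := (deriv_theta1_ne_zero_and_primeK_eq τ).1
  rw [Complex.exp_add, Complex.exp_log hd, exp_logPrime h0 hz, primeK, mul_div_cancel₀ _ hd]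

lemma exists_isLogTheta1 (τ : UpperHalfPlane) : ∃ ℓ : ℂ → ℂ, IsLogTheta1 τ ℓ :=
  ⟨fun z => Complex.log (deriv (fun u : ℂ => theta1 u τ) 0) + logPrime (nome τ) z,
    continuousOn_const.add (continuousOn_logPrime τ),
    fun _ h0 hz => (theta1_eq_exp h0 hz).symm⟩

lemma sub_eq_sub_of_exp_eq {S : Set ℂ} (hS : IsPreconnected S) {f g : ℂ → ℂ}
    (hf : ContinuousOn f S) (hg : ContinuousOn g S)
    (h : ∀ z ∈ S, Complex.exp (f z) = Complex.exp (g z)) {a b : ℂ} (ha : a ∈ S) (hb : b ∈ S) :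
    f a - g a = f b - g b := by
  have hT : IsDiscrete (Set.range fun n : ℤ => (n : ℂ) * (2 * Real.pi * Complex.I)) := by
    have hc : (2 * Real.pi * Complex.I : ℂ) ≠ 0 := Complex.two_pi_I_ne_zero
    have hf := ((Homeomorph.mulRight₀ _ hc).isInducing.comp
      Complex.isometry_ofReal.isEmbedding.isInducing).comp
      Int.isClosedEmbedding_coe_real.isEmbedding.isInducing
    have h := (IsDiscrete.univ (X := ℤ)).image hf
    rw [Set.image_univ] at h
    convert! h using 2
  refine hS.constant_of_mapsTo hT (hf.sub hg) (fun z hz => ?_) ha hb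
  obtain ⟨n, hn⟩ := Complex.exp_eq_exp_iff_exists_int.1 (h z hz)
  exact ⟨n, by rw [Pi.sub_apply, hn]; ring⟩

/-- Differences of a branch of `log ϑ₁` do not depend on the branch. -/
lemma IsLogTheta1.sub_eq {τ : UpperHalfPlane} {ℓ : ℂ → ℂ} (hℓ : IsLogTheta1 τ ℓ) {a b : ℂ}
    (ha : 0 < a.re ∧ a.re < 2 * Real.pi * τ.im) (hb : 0 < b.re ∧ b.re < 2 * Real.pi * τ.im) :
    ℓ a - ℓ b = logPrime (nome τ) a - logPrime (nome τ) b := by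
  have hS : IsPreconnected {z : ℂ | 0 < z.re ∧ z.re < 2 * Real.pi * τ.im} :=
    ((convex_halfSpace_re_gt 0).inter (convex_halfSpace_re_lt _)).isPreconnected
  have h := sub_eq_sub_of_exp_eq hS hℓ.1 (g := fun z =>
      Complex.log (deriv (fun u : ℂ => theta1 u τ) 0) + logPrime (nome τ) z)
    (continuousOn_const.add (continuousOn_logPrime τ))
    (fun z hz => (hℓ.2 z hz.1 hz.2).trans (theta1_eq_exp hz.1 hz.2)) ha hb
  linear_combination h

end PrimeForm

/-! ### The addition formula for `ϑ₁` -/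

section ThetaAddition

/-- The point `2τ`; the products `ϑ₁(x + y) ϑ₁(x - y)` are bilinear in theta functions at `2τ`. -/
noncomputable def doubleTau (τ : UpperHalfPlane) : UpperHalfPlane :=
  UpperHalfPlane.mk (2 * (τ : ℂ)) (by simpa using τ.im_pos)

lemma coe_doubleTau (τ : UpperHalfPlane) : (doubleTau τ : ℂ) = 2 * (τ : ℂ) := rfl

/-- The pairs of integers of odd and of even sum, parametrised by sums and differences. -/
noncomputable def sumDiffEquiv : (ℤ × ℤ) ⊕ (ℤ × ℤ) ≃ ℤ × ℤ :=
  Equiv.ofBijective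
    (Sum.elim (fun p => (p.1 + p.2, p.1 - p.2 - 1)) fun p => (p.1 + p.2, p.1 - p.2)) <| by
    constructor
    · rintro (⟨a, b⟩ | ⟨a, b⟩) (⟨c, d⟩ | ⟨c, d⟩) h <;>
        simp only [Sum.elim_inl, Sum.elim_inr, Prod.mk.injEq, Sum.inl.injEq, Sum.inr.injEq,
          reduceCtorEq] at h ⊢ <;> omega
    · rintro ⟨m, n⟩
      rcases Int.even_or_odd' (m + n) with ⟨k, hk | hk⟩
      · exact ⟨Sum.inr (k, m - k), Prod.ext (by dsimp; omega) (by dsimp; omega)⟩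
      · exact ⟨Sum.inl (k + 1, m - k - 1), Prod.ext (by dsimp; omega) (by dsimp; omega)⟩

lemma sumDiffEquiv_inl (p : ℤ × ℤ) :
    sumDiffEquiv (Sum.inl p) = (p.1 + p.2, p.1 - p.2 - 1) := rfl

lemma sumDiffEquiv_inr (p : ℤ × ℤ) :
    sumDiffEquiv (Sum.inr p) = (p.1 + p.2, p.1 - p.2) := rfl

/-- The products of the terms of two theta series with indices `m`, `n` become, after the
substitution `a = (m + n) / 2`, `b = (m - n) / 2`, products of terms at `2τ`; the two summands come
from odd and even `m + n`. -/
lemma theta1_add_mul_theta1_sub (x y : ℂ) (τ : UpperHalfPlane) :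
    theta1 (x + y) τ * theta1 (x - y) τ =
      theta 0 0 (2 * x) (doubleTau τ) * theta (1 / 2) 0 (2 * y) (doubleTau τ) -
        theta (1 / 2) 0 (2 * x) (doubleTau τ) * theta 0 0 (2 * y) (doubleTau τ) := by
  have h1 := sumDiffEquiv.hasSum_iff.2 (hasSum_mul_prod
    (hasSum_thetaTerm (1 / 2) (1 / 2) (x + y) τ) (hasSum_thetaTerm (1 / 2) (1 / 2) (x - y) τ))
  have h2 := hasSum_mul_prod (hasSum_thetaTerm 0 0 (2 * x) (doubleTau τ))
    (hasSum_thetaTerm (1 / 2) 0 (2 * y) (doubleTau τ))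
  have h3 := (hasSum_mul_prod (hasSum_thetaTerm (1 / 2) 0 (2 * x) (doubleTau τ))
    (hasSum_thetaTerm 0 0 (2 * y) (doubleTau τ))).neg
  refine (h1.unique (HasSum.sum ?_ ?_)).trans (sub_eq_add_neg _ _).symm
  · convert! h2 using 1
    funext p
    have he := Complex.exp_int_mul_two_pi_mul_I p.1
    rw [Function.comp_apply, Function.comp_apply, sumDiffEquiv_inl]
    simp only [thetaTerm]
    rw [← Complex.exp_add, ← Complex.exp_add, coe_doubleTau]
    conv_rhs => rw [← mul_one (Complex.exp _), ← he, ← Complex.exp_add]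
    congr 1
    push_cast
    ring
  · convert! h3 using 1
    funext p
    have he := Complex.exp_int_mul_two_pi_mul_I p.1
    rw [Function.comp_apply, Function.comp_apply, sumDiffEquiv_inr]
    simp only [thetaTerm]
    rw [← Complex.exp_add, ← Complex.exp_add, coe_doubleTau, ← mul_neg_one,
      ← Complex.exp_pi_mul_I, ← mul_one (_ * Complex.exp (_ * Complex.I)), ← he,
      ← Complex.exp_add, ← Complex.exp_add]
    congr 1
    push_cast
    ring

lemma exists_theta1_ne_zero (τ : UpperHalfPlane) : ∃ z, theta1 z τ ≠ 0 := by
  have h : 0 < Real.pi * τ.im := mul_pos Real.pi_pos τ.im_pos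
  refine ⟨((Real.pi * τ.im : ℝ) : ℂ), ?_⟩
  rw [theta1_eq_exp (by simpa using h) (by rw [Complex.ofReal_re]; linarith)]
  exact Complex.exp_ne_zero _

lemma theta1_neg (z : ℂ) (τ : UpperHalfPlane) : theta1 (-z) τ = -theta1 z τ := by
  obtain ⟨s, hs⟩ := exists_theta1_ne_zero τ
  have h1 := theta1_add_mul_theta1_sub ((s + z) / 2) ((s - z) / 2) τ
  have h2 := theta1_add_mul_theta1_sub ((s - z) / 2) ((s + z) / 2) τ
  rw [show (s + z) / 2 + (s - z) / 2 = s by ring, show (s + z) / 2 - (s - z) / 2 = z by ring] at h1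
  rw [show (s - z) / 2 + (s + z) / 2 = s by ring, show (s - z) / 2 - (s + z) / 2 = -z by ring] at h2
  refine mul_left_cancel₀ hs ?_
  linear_combination h1 + h2

/-- The three-term relation for `ϑ₁`, the Plücker relation for the bilinear form of
`theta1_add_mul_theta1_sub`. -/
lemma theta1_three_term (P Q R S : ℂ) (τ : UpperHalfPlane) :
    theta1 (P + Q) τ * theta1 (P - Q) τ * (theta1 (R + S) τ * theta1 (R - S) τ) -
      theta1 (P + R) τ * theta1 (P - R) τ * (theta1 (Q + S) τ * theta1 (Q - S) τ) +
      theta1 (P + S) τ * theta1 (P - S) τ * (theta1 (Q + R) τ * theta1 (Q - R) τ) = 0 := by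
  simp only [theta1_add_mul_theta1_sub]
  ring

lemma primeK_neg (z : ℂ) (τ : UpperHalfPlane) : primeK (-z) τ = -primeK z τ := by
  rw [primeK, primeK, theta1_neg, neg_div]

lemma theta_eq_exp_mul_theta1 (α β : ℝ) (z : ℂ) (τ : UpperHalfPlane) :
    theta α β z τ = Complex.exp ((α - 1 / 2) * z +
        (Real.pi * Complex.I * (α - 1 / 2) ^ 2 * (τ : ℂ) +
          (α - 1 / 2) * (2 * Real.pi * Complex.I * β))) *
      theta1 (z + (2 * Real.pi * Complex.I * (β - 1 / 2 + (α - 1 / 2) * (τ : ℂ)))) τ := by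
  refine (hasSum_thetaTerm α β z τ).unique ?_
  convert! (hasSum_thetaTerm (1 / 2) (1 / 2) _ τ).mul_left _ using 1
  funext n
  rw [thetaTerm, thetaTerm, ← Complex.exp_add]
  congr 1
  push_cast
  ring

/-- The three-term relation for `ϑ[α; β]` and the prime form, i.e. the case `n = 2` of the Frobenius
determinant formula. The characteristics only shift the argument `P` of `theta1_three_term`. -/
lemma theta_primeK_relation (α β : ℝ) (τ : UpperHalfPlane) (a x y x' y' : ℂ) :
    theta α β (a + x - y) τ * theta α β (a + x' - y') τ * (primeK (x - y') τ * primeK (x' - y) τ) -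
      theta α β (a + x - y') τ * theta α β (a + x' - y) τ *
        (primeK (x - y) τ * primeK (x' - y') τ) =
      theta α β a τ * theta α β (a + x + x' - y - y') τ *
        (primeK (x - x') τ * primeK (y' - y) τ) := by
  simp only [theta_eq_exp_mul_theta1 α β, primeK]
  set δ : ℂ := (α : ℂ) - 1 / 2
  set d : ℂ := Real.pi * Complex.I * δ ^ 2 * (τ : ℂ) + δ * (2 * Real.pi * Complex.I * β)
  set u : ℂ := 2 * Real.pi * Complex.I * (β - 1 / 2 + δ * (τ : ℂ))
  set D := deriv (fun u : ℂ => theta1 u τ) 0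
  have h := theta1_three_term (a + u + (x + x' - y - y') / 2) ((x - x' + y' - y) / 2)
    ((x - x' - y' + y) / 2) ((x + x' - y - y') / 2) τ
  have e1 : Complex.exp (δ * (a + x - y) + d) * Complex.exp (δ * (a + x' - y') + d) =
      Complex.exp (δ * (2 * a + x + x' - y - y') + 2 * d) := by
    rw [← Complex.exp_add]; congr 1; ring
  have e2 : Complex.exp (δ * (a + x - y') + d) * Complex.exp (δ * (a + x' - y) + d) =
      Complex.exp (δ * (2 * a + x + x' - y - y') + 2 * d) := by
    rw [← Complex.exp_add]; congr 1; ring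
  have e3 : Complex.exp (δ * a + d) * Complex.exp (δ * (a + x + x' - y - y') + d) =
      Complex.exp (δ * (2 * a + x + x' - y - y') + 2 * d) := by
    rw [← Complex.exp_add]; congr 1; ring
  set E := Complex.exp (δ * (2 * a + x + x' - y - y') + 2 * d)
  rw [show a + u + (x + x' - y - y') / 2 + (x - x' + y' - y) / 2 = a + x - y + u by ring,
    show a + u + (x + x' - y - y') / 2 - (x - x' + y' - y) / 2 = a + x' - y' + u by ring,
    show a + u + (x + x' - y - y') / 2 + (x - x' - y' + y) / 2 = a + x - y' + u by ring,
    show a + u + (x + x' - y - y') / 2 - (x - x' - y' + y) / 2 = a + x' - y + u by ring,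
    show a + u + (x + x' - y - y') / 2 + (x + x' - y - y') / 2 = a + x + x' - y - y' + u by ring,
    show a + u + (x + x' - y - y') / 2 - (x + x' - y - y') / 2 = a + u by ring,
    show (x - x' - y' + y) / 2 + (x + x' - y - y') / 2 = x - y' by ring,
    show (x - x' - y' + y) / 2 - (x + x' - y - y') / 2 = -(x' - y) by ring,
    show (x - x' + y' - y) / 2 + (x + x' - y - y') / 2 = x - y by ring,
    show (x - x' + y' - y) / 2 - (x + x' - y - y') / 2 = -(x' - y') by ring,
    show (x - x' + y' - y) / 2 + (x - x' - y' + y) / 2 = x - x' by ring,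
    show (x - x' + y' - y) / 2 - (x - x' - y' + y) / 2 = y' - y by ring,
    theta1_neg, theta1_neg] at h
  linear_combination (-E / D ^ 2) * h +
    (theta1 (a + x - y + u) τ * theta1 (a + x' - y' + u) τ * theta1 (x - y') τ *
      theta1 (x' - y) τ / D ^ 2) * e1 -
    (theta1 (a + x - y' + u) τ * theta1 (a + x' - y + u) τ * theta1 (x - y) τ *
      theta1 (x' - y') τ / D ^ 2) * e2 -
    (theta1 (a + u) τ * theta1 (a + x + x' - y - y' + u) τ * theta1 (x - x') τ *
      theta1 (y' - y) τ / D ^ 2) * e3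

lemma differentiable_theta (α β : ℝ) (τ : UpperHalfPlane) :
    Differentiable ℂ fun z => theta α β z τ := by
  have h : (fun z => theta α β z τ) = fun z : ℂ =>
      Complex.exp (Real.pi * Complex.I * (α : ℂ) ^ 2 * (τ : ℂ) +
      (α : ℂ) * (z + 2 * Real.pi * Complex.I * (β : ℂ))) *
      jacobiTheta₂ (z / (2 * Real.pi * Complex.I) + (β + α * (τ : ℂ))) τ := by
    funext z
    have h1 := (hasSum_jacobiTheta₂_term (z / (2 * Real.pi * Complex.I) + (β + α * (τ : ℂ)))
      τ.im_pos).mul_left (Complex.exp (Real.pi * Complex.I * (α : ℂ) ^ 2 * (τ : ℂ) +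
      (α : ℂ) * (z + 2 * Real.pi * Complex.I * (β : ℂ))))
    refine (hasSum_thetaTerm α β z τ).unique ?_
    convert! h1 using 1
    exact funext fun n => thetaTerm_eq_jacobi α β z τ n
  rw [h]
  refine Differentiable.mul (by fun_prop) fun z => ?_
  exact (differentiableAt_jacobiTheta₂_fst _ τ.im_pos).comp z (by fun_prop)

lemma dense_theta_ne_zero (α β : ℝ) (τ : UpperHalfPlane) : Dense {z | theta α β z τ ≠ 0} := by
  obtain ⟨s, hs⟩ := exists_theta1_ne_zero τ
  intro z
  by_contra hz
  have h1 : (fun z => theta α β z τ) =ᶠ[𝓝 z] 0 := by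
    rw [mem_closure_iff_frequently, not_frequently] at hz
    exact hz.mono fun w hw => not_not.1 hw
  have h2 := (differentiable_theta α β τ).differentiableOn.analyticOnNhd isOpen_univ
  have h3 := congrFun (h2.eq_of_eventuallyEq analyticOnNhd_const h1)
    (s - 2 * Real.pi * Complex.I * (β - 1 / 2 + (α - 1 / 2) * (τ : ℂ)))
  simp only [theta_eq_exp_mul_theta1 α β, sub_add_cancel] at h3
  exact mul_ne_zero (Complex.exp_ne_zero _) hs h3

end ThetaAddition

/-! ### The Frobenius determinant formula -/

section Frobenius

/-- The ratio `∏_{i<j} K(x_i - x_j) K(y_j - y_i) / ∏_{i,j} K(x_i - y_j)`, built by adding the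
points `x 0`, `y 0` to the remaining ones. -/
noncomputable def cauchyProd (K : ℂ → ℂ) : (n : ℕ) → (Fin n → ℂ) → (Fin n → ℂ) → ℂ
  | 0, _, _ => 1
  | n + 1, x, y => (K (x 0 - y 0))⁻¹ *
      ((∏ i : Fin n, K (x i.succ - x 0) / K (x i.succ - y 0)) *
        ∏ j : Fin n, K (y 0 - y j.succ) / K (x 0 - y j.succ)) *
      cauchyProd K n (fun i => x i.succ) fun i => y i.succ

/-- Expansion of a determinant through the Schur complement of its first entry. -/
lemma det_eq_mul_det_schur {R : Type*} [Field R] {n : ℕ} (M : Matrix (Fin (n + 1)) (Fin (n + 1)) R)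
    (h : M 0 0 ≠ 0) :
    M.det = M 0 0 * (Matrix.of fun i j : Fin n =>
      M i.succ j.succ - M i.succ 0 * M 0 j.succ / M 0 0).det := by
  set B : Matrix (Fin (n + 1)) (Fin (n + 1)) R := Matrix.of fun i j =>
    M i j - (if i = 0 then 0 else M i 0 / M 0 0) * M 0 j
  have hB : M.det = B.det := by
    refine Matrix.det_eq_of_forall_row_eq_smul_add_const
      (fun i => if i = 0 then 0 else M i 0 / M 0 0) 0 (by simp) fun i j => ?_
    simp [B]
  have h0 : ∀ i : Fin n, B i.succ 0 = 0 := fun i => by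
    simp [B, div_mul_cancel₀ _ h]
  rw [hB, Matrix.det_succ_column_zero, Fin.sum_univ_succ]
  simp only [h0, mul_zero, zero_mul, Finset.sum_const_zero, add_zero]
  simp only [Fin.val_zero, pow_zero, one_mul, Fin.succAbove_zero]
  congr 1
  · simp [B]
  · congr 1
    ext i j
    simp [B, div_mul_eq_mul_div]

variable {Θ K : ℂ → ℂ}

/-- The Frobenius determinant formula, for functions satisfying the three-term relation. The
induction takes the Schur complement of the first entry; the relation shows that it is of the same
form, with `a` replaced by `a + x 0 - y 0`. -/
theorem frobenius_det (hc : Continuous Θ) (hd : Dense {z | Θ z ≠ 0}) (hodd : ∀ z, K (-z) = -K z)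
    (hrel : ∀ a x y x' y', Θ (a + x - y) * Θ (a + x' - y') * (K (x - y') * K (x' - y)) -
      Θ (a + x - y') * Θ (a + x' - y) * (K (x - y) * K (x' - y')) =
      Θ a * Θ (a + x + x' - y - y') * (K (x - x') * K (y' - y)))
    (n : ℕ) (x y : Fin n → ℂ) (hK : ∀ i j, K (x i - y j) ≠ 0) (a : ℂ) :
    Θ a * (Matrix.of fun i j => Θ (a + x i - y j) / K (x i - y j)).det =
      Θ a ^ n * Θ (a + ∑ i, (x i - y i)) * cauchyProd K n x y := by
  induction n generalizing a with
  | zero => simp [cauchyProd]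
  | succ n ih =>
    have hcd : Continuous fun a =>
        (Matrix.of fun i j => Θ (a + x i - y j) / K (x i - y j)).det :=
      Continuous.matrix_det (continuous_matrix fun i j => by
        simp only [Matrix.of_apply]
        fun_prop)
    have hdense : Dense ({z | Θ z ≠ 0} ∩ {z | Θ (z + (x 0 - y 0)) ≠ 0}) := by
      refine Dense.inter_of_isOpen_left hd ?_ (isOpen_ne_fun hc continuous_const)
      exact hd.preimage (Homeomorph.addRight (x 0 - y 0)).isOpenMap
    revert a
    -- By continuity in `a`, the values of `Θ` that are divided by may be assumed nonzero.
    refine congrFun (Continuous.ext_on hdense (by fun_prop) (by fun_prop) ?_)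
    rintro a ⟨ha, ha'⟩
    replace ha : Θ a ≠ 0 := ha
    replace ha' : Θ (a + x 0 - y 0) ≠ 0 := by rw [add_sub_assoc]; exact ha'
    beta_reduce
    rw [det_eq_mul_det_schur _ (div_ne_zero ha' (hK 0 0))]
    have hS : (Matrix.of fun i j : Fin n =>
        (Matrix.of fun i j => Θ (a + x i - y j) / K (x i - y j)) i.succ j.succ -
          (Matrix.of fun i j => Θ (a + x i - y j) / K (x i - y j)) i.succ 0 *
          (Matrix.of fun i j => Θ (a + x i - y j) / K (x i - y j)) 0 j.succ /
          (Matrix.of fun i j => Θ (a + x i - y j) / K (x i - y j)) 0 0) =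
        Matrix.of fun i j : Fin n => (Θ a / Θ (a + x 0 - y 0) *
          (K (x i.succ - x 0) / K (x i.succ - y 0))) *
          (Matrix.of fun i j : Fin n => (K (y 0 - y j.succ) / K (x 0 - y j.succ)) *
          (Matrix.of fun i j : Fin n => Θ (a + x 0 - y 0 + x i.succ - y j.succ) /
            K (x i.succ - y j.succ)) i j) i j := by
      ext i j
      simp only [Matrix.of_apply]
      have h := hrel a (x 0) (y 0) (x i.succ) (y j.succ)
      rw [← neg_sub (x i.succ) (x 0), ← neg_sub (y 0) (y j.succ), hodd, hodd,
        show a + x 0 + x i.succ - y 0 - y j.succ = a + x 0 - y 0 + x i.succ - y j.succ by ring] at h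
      have h00 := hK 0 0
      have hi0 := hK i.succ 0
      have h0j := hK 0 j.succ
      have hij := hK i.succ j.succ
      field_simp
      linear_combination h
    rw [hS, Matrix.det_mul_column, Matrix.det_mul_row, Finset.prod_mul_distrib, Finset.prod_const,
      Finset.card_univ, Fintype.card_fin, Matrix.of_apply, Fin.sum_univ_succ, cauchyProd]
    have h := ih (fun i => x i.succ) (fun i => y i.succ) (fun i j => hK _ _) (a + x 0 - y 0)
    rw [show a + x 0 - y 0 + ∑ i : Fin n, (x i.succ - y i.succ) =
      a + (x 0 - y 0 + ∑ i : Fin n, (x i.succ - y i.succ)) by ring] at h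
    have h00 := hK 0 0
    rw [div_pow, pow_succ]
    generalize (∏ i : Fin n, K (x i.succ - x 0) / K (x i.succ - y 0)) = r
    generalize (∏ j : Fin n, K (y 0 - y j.succ) / K (x 0 - y j.succ)) = s
    field_simp
    linear_combination r * s * h

end Frobenius

/-! ### The interactions between the insertions of the generating form -/

section Insertions

/-- The domain `|q|⁻¹ > |e^{x₁}| > |e^{y₁}| > ⋯ > |e^{x_n}| > |e^{y_n}| > |e^w| > 1`. -/
structure InDomain (τ : UpperHalfPlane) (w : ℂ) {n : ℕ} (x y : Fin n → ℂ) : Prop where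
  zero_lt_w : 0 < w.re
  w_lt : w.re < 2 * Real.pi * τ.im
  x_lt : ∀ i, (x i).re < 2 * Real.pi * τ.im
  y_lt_x : ∀ i, (y i).re < (x i).re
  x_lt_y : ∀ i j, i < j → (x j).re < (y i).re
  w_lt_y : ∀ i, w.re < (y i).re

lemma InDomain.tail {τ : UpperHalfPlane} {w : ℂ} {n : ℕ} {x y : Fin (n + 1) → ℂ}
    (h : InDomain τ w x y) : InDomain τ w (fun i => x i.succ) fun i => y i.succ :=
  ⟨h.zero_lt_w, h.w_lt, fun _ => h.x_lt _, fun _ => h.y_lt_x _,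
    fun _ _ hij => h.x_lt_y _ _ (Fin.succ_lt_succ_iff.2 hij), fun _ => h.w_lt_y _⟩

lemma generatingInsertions_zero (κ : ℝ) (w : ℂ) (x y : Fin 0 → ℂ) :
    generatingInsertions κ w x y = basicInsertions κ w := by
  simp [generatingInsertions]

lemma generatingInsertions_succ (κ : ℝ) (w : ℂ) {n : ℕ} (x y : Fin (n + 1) → ℂ) :
    generatingInsertions κ w x y = (1, x 0) :: (-1, y 0) ::
      generatingInsertions κ w (fun i => x i.succ) fun i => y i.succ := by
  simp [generatingInsertions, List.ofFn_succ]

lemma sum_map_generatingInsertions (κ : ℝ) (w : ℂ) (f : ℂ → ℂ) {n : ℕ} (x y : Fin n → ℂ) :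
    ((generatingInsertions κ w x y).map fun b => b.1 * f b.2).sum =
      ∑ i, (f (x i) - f (y i)) + κ * (f w - f 0) := by
  induction n with
  | zero =>
    rw [generatingInsertions_zero]
    simp [basicInsertions]
    ring
  | succ n ih =>
    rw [generatingInsertions_succ, List.map_cons, List.map_cons, List.sum_cons, List.sum_cons, ih,
      Fin.sum_univ_succ]
    ring

lemma chargeSum_generatingInsertions (κ : ℝ) (w : ℂ) {n : ℕ} (x y : Fin n → ℂ) :
    chargeSum (generatingInsertions κ w x y) = 0 := by
  simpa [chargeSum] using sum_map_generatingInsertions κ w (fun _ => 1) x y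

lemma forall_mem_generatingInsertions {p : ℂ → Prop} (κ : ℝ) {w : ℂ} {n : ℕ} {x y : Fin n → ℂ}
    (hx : ∀ i, p (x i)) (hy : ∀ i, p (y i)) (hw : p w) (h0 : p 0) :
    ∀ b ∈ generatingInsertions κ w x y, p b.2 := by
  induction n with
  | zero =>
    rw [generatingInsertions_zero]
    simp [basicInsertions, hw, h0]
  | succ n ih =>
    rw [generatingInsertions_succ, List.forall_mem_cons, List.forall_mem_cons]
    exact ⟨hx 0, hy 0, ih (fun i => hx _) fun i => hy _⟩

lemma InDomain.radiallyOrdered (κ : ℝ) {τ : UpperHalfPlane} {w : ℂ} {n : ℕ} {x y : Fin n → ℂ}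
    (h : InDomain τ w x y) : RadiallyOrdered (nome τ) (generatingInsertions κ w x y) := by
  have key : ∀ a b : ℂ, a.re < 2 * Real.pi * τ.im → 0 ≤ b.re ∧ b.re < a.re →
      0 < (a - b).re ∧ ‖nome τ‖ * Real.exp (a - b).re < 1 := fun a b ha hb => by
    rw [Complex.sub_re]
    exact ⟨by linarith, norm_nome_mul_exp_lt_one (by linarith)⟩
  induction n with
  | zero =>
    rw [generatingInsertions_zero]
    simpa [RadiallyOrdered, basicInsertions] using key w 0 h.w_lt (by simpa using h.zero_lt_w)
  | succ n ih =>
    have hy0 : ∀ b ∈ generatingInsertions κ w (fun i => x i.succ) (fun i => y i.succ),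
        0 ≤ b.2.re ∧ b.2.re < (y 0).re := by
      have hw := h.zero_lt_w
      have hwy := h.w_lt_y
      refine forall_mem_generatingInsertions (p := fun z => 0 ≤ z.re ∧ z.re < (y 0).re) κ
        (fun i => ?_) (fun i => ?_) ⟨hw.le, hwy 0⟩ ⟨by simp, by simpa using hw.trans (hwy 0)⟩
      all_goals
        have h1 := h.y_lt_x i.succ
        have h2 := h.x_lt_y 0 i.succ i.succ_pos
        have h3 := hwy i.succ
        constructor <;> linarith
    have h0 := h.y_lt_x 0
    have hx := h.x_lt 0
    have hy := h.zero_lt_w.trans (h.w_lt_y 0)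
    rw [RadiallyOrdered, generatingInsertions_succ, List.pairwise_cons, List.pairwise_cons,
      List.forall_mem_cons]
    exact ⟨⟨key _ _ hx ⟨hy.le, h0⟩, fun b hb =>
      key _ _ hx ⟨(hy0 b hb).1, (hy0 b hb).2.trans h0⟩⟩,
      fun b hb => key _ _ (h0.trans hx) (hy0 b hb), ih h.tail⟩

/-- The interaction of the pair `x`, `y` with the insertions at `w` and `0`. -/
noncomputable def twist (τ : UpperHalfPlane) (κ : ℝ) (w x y : ℂ) : ℂ :=
  Complex.exp (κ * (logPrime (nome τ) (x - w) - logPrime (nome τ) x)) *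
    Complex.exp (κ * (logPrime (nome τ) y - logPrime (nome τ) (y - w)))

/-- The interactions of the first pair of insertions with all later ones give the first factors of
the twists and of the Cauchy product. -/
lemma exp_pairSum_generatingInsertions (κ : ℝ) {τ : UpperHalfPlane} {w : ℂ} {n : ℕ}
    {x y : Fin n → ℂ} (h : InDomain τ w x y) :
    Complex.exp (pairSum (fun a b => a.1 * b.1 * logPrime (nome τ) (a.2 - b.2))
        (generatingInsertions κ w x y)) =
      Complex.exp (pairSum (fun a b => a.1 * b.1 * logPrime (nome τ) (a.2 - b.2))
        (basicInsertions κ w)) * (∏ i, twist τ κ w (x i) (y i)) *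
        cauchyProd (fun z => primeK z τ) n x y := by
  induction n with
  | zero => simp [generatingInsertions_zero, cauchyProd]
  | succ n ih =>
    have hx0 := h.x_lt 0
    have hxy0 := h.y_lt_x 0
    have hy0 := h.zero_lt_w.trans (h.w_lt_y 0)
    have hs := sum_map_generatingInsertions κ w (fun z => logPrime (nome τ) (x 0 - z) -
      logPrime (nome τ) (y 0 - z)) (fun i => x i.succ) fun i => y i.succ
    have e1 : pairSum (fun a b => a.1 * b.1 * logPrime (nome τ) (a.2 - b.2))
        (generatingInsertions κ w x y) = -logPrime (nome τ) (x 0 - y 0) +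
        ((generatingInsertions κ w (fun i => x i.succ) fun i => y i.succ).map fun b =>
          b.1 * (logPrime (nome τ) (x 0 - b.2) - logPrime (nome τ) (y 0 - b.2))).sum +
        pairSum (fun a b => a.1 * b.1 * logPrime (nome τ) (a.2 - b.2))
          (generatingInsertions κ w (fun i => x i.succ) fun i => y i.succ) := by
      rw [generatingInsertions_succ]
      generalize generatingInsertions κ w (fun i => x i.succ) (fun i => y i.succ) = L
      have e0 : (L.map fun b => b.1 * (logPrime (nome τ) (x 0 - b.2) -
          logPrime (nome τ) (y 0 - b.2))).sum =
          (L.map fun b => 1 * b.1 * logPrime (nome τ) (x 0 - b.2)).sum +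
          (L.map fun b => -1 * b.1 * logPrime (nome τ) (y 0 - b.2)).sum := by
        rw [← List.sum_map_add]
        congr 2
        funext b
        ring
      rw [e0]
      simp only [pairSum, List.map_cons, List.sum_cons]
      ring
    have hK : ∀ z z' : ℂ, 0 ≤ z'.re → z'.re < z.re → z.re < 2 * Real.pi * τ.im →
        Complex.exp (logPrime (nome τ) (z - z')) = primeK (z - z') τ := fun z z' h1 h2 h3 =>
      exp_logPrime (by rw [Complex.sub_re]; linarith) (by rw [Complex.sub_re]; linarith)
    have e2 : ∀ i : Fin n, Complex.exp (logPrime (nome τ) (x 0 - x i.succ) -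
        logPrime (nome τ) (y 0 - x i.succ) -
        (logPrime (nome τ) (x 0 - y i.succ) - logPrime (nome τ) (y 0 - y i.succ))) =
        primeK (x i.succ - x 0) τ / primeK (x i.succ - y 0) τ *
        (primeK (y 0 - y i.succ) τ / primeK (x 0 - y i.succ) τ) := fun i => by
      have h1 := h.y_lt_x i.succ
      have h2 := h.x_lt_y 0 i.succ i.succ_pos
      have h3 := h.zero_lt_w.trans (h.w_lt_y i.succ)
      rw [Complex.exp_sub, Complex.exp_sub, Complex.exp_sub,
        hK (x 0) (x i.succ) (by linarith) (by linarith) (by linarith),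
        hK (y 0) (x i.succ) (by linarith) (by linarith) (by linarith),
        hK (x 0) (y i.succ) (by linarith) (by linarith) (by linarith),
        hK (y 0) (y i.succ) (by linarith) (by linarith) (by linarith),
        ← neg_sub (x 0) (x i.succ), ← neg_sub (y 0) (x i.succ), primeK_neg, primeK_neg,
        neg_div_neg_eq,
        div_div_eq_mul_div, mul_div_assoc]
    rw [e1, hs, Complex.exp_add, Complex.exp_add, Complex.exp_add, Complex.exp_sum, ih h.tail,
      Finset.prod_congr rfl fun i _ => e2 i, Finset.prod_mul_distrib, Complex.exp_neg,
      hK _ _ hy0.le hxy0 hx0, Fin.prod_univ_succ, cauchyProd]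
    have e3 : Complex.exp (κ * (logPrime (nome τ) (x 0 - w) - logPrime (nome τ) (y 0 - w) -
        (logPrime (nome τ) (x 0 - 0) - logPrime (nome τ) (y 0 - 0)))) =
        twist τ κ w (x 0) (y 0) := by
      rw [twist, ← Complex.exp_add, sub_zero, sub_zero]
      congr 1
      ring
    rw [e3]
    ring

end Insertions

/-! ### The determinant of the twisted Szegő kernel -/

section Szego

lemma det_szegoMatrix (ℓ : ℂ → ℂ) (α β : ℝ) (τ : UpperHalfPlane) (κ : ℝ) (w : ℂ) {n : ℕ}
    (x y : Fin n → ℂ) :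
    (szegoMatrix ℓ α β τ κ w x y).det =
      MvPolynomial.C (Matrix.of fun i j => szego ℓ α β τ κ w (x i) (y j)).det *
        ∏ i : Fin n, (dxHalf i * dyHalf i) := by
  have h : szegoMatrix ℓ α β τ κ w x y = Matrix.of fun i j => dxHalf i *
      (Matrix.of fun i j => dyHalf j * (MvPolynomial.C (σ := Fin n ⊕ Fin n)).mapMatrix
        (Matrix.of fun i j => szego ℓ α β τ κ w (x i) (y j)) i j) i j := by
    ext1 i j
    simp only [szegoMatrix, Matrix.of_apply, RingHom.mapMatrix_apply, Matrix.map_apply]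
    ring
  rw [h, Matrix.det_mul_column, Matrix.det_mul_row, ← RingHom.map_det, Finset.prod_mul_distrib]
  ring

lemma det_szego {α β : ℝ} {τ : UpperHalfPlane} {κ : ℝ} {w : ℂ} {n : ℕ} {x y : Fin n → ℂ}
    (h : InDomain τ w x y) (hθ : theta α β (κ * w) τ ≠ 0) {ℓ : ℂ → ℂ} (hℓ : IsLogTheta1 τ ℓ) :
    theta α β (κ * w) τ * (Matrix.of fun i j => szego ℓ α β τ κ w (x i) (y j)).det =
      (∏ i, twist τ κ w (x i) (y i)) * (theta α β (κ * w + ∑ i, (x i - y i)) τ *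
        cauchyProd (fun z => primeK z τ) n x y) := by
  have hstrip : ∀ z : ℂ, w.re < z.re → z.re < 2 * Real.pi * τ.im →
      ℓ (z - w) - ℓ z = logPrime (nome τ) (z - w) - logPrime (nome τ) z := fun z h1 h2 => by
    have h3 := h.zero_lt_w
    exact hℓ.sub_eq ⟨by rw [Complex.sub_re]; linarith, by rw [Complex.sub_re]; linarith⟩
      ⟨by linarith, h2⟩
  have hK : ∀ i j, primeK (x i - y j) τ ≠ 0 := fun i j => by
    have h1 := h.x_lt i
    have h2 := h.x_lt j
    have h3 := h.y_lt_x i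
    have h4 := h.y_lt_x j
    have h5 := h.w_lt_y i
    have h6 := h.w_lt_y j
    have h7 := h.zero_lt_w
    rcases le_or_gt i j with hij | hij
    · have : (y j).re < (x i).re := by
        rcases hij.eq_or_lt with rfl | hij
        · exact h3
        · have := h.x_lt_y i j hij
          linarith
      exact primeK_ne_zero (by rw [Complex.sub_re]; linarith) (by rw [Complex.sub_re]; linarith)
    · have := h.x_lt_y j i hij
      rw [← neg_sub, primeK_neg, neg_ne_zero]
      exact primeK_ne_zero (by rw [Complex.sub_re]; linarith) (by rw [Complex.sub_re]; linarith)
  have hM : (Matrix.of fun i j => szego ℓ α β τ κ w (x i) (y j)) = Matrix.of fun i j =>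
      ((theta α β (κ * w) τ)⁻¹ *
        Complex.exp (κ * (logPrime (nome τ) (x i - w) - logPrime (nome τ) (x i)))) *
      (Matrix.of fun i j =>
        Complex.exp (κ * (logPrime (nome τ) (y j) - logPrime (nome τ) (y j - w))) *
        (Matrix.of fun i j => theta α β (κ * w + x i - y j) τ / primeK (x i - y j) τ) i j) i j := by
    ext i j
    have h1 := hstrip (x i) ((h.w_lt_y i).trans (h.y_lt_x i)) (h.x_lt i)
    have h2 := hstrip (y j) (h.w_lt_y j) ((h.y_lt_x j).trans (h.x_lt j))
    simp only [Matrix.of_apply, szego]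
    rw [← h1, ← neg_sub (logPrime (nome τ) (y j - w)), ← h2,
      show ℓ (x i - w) + ℓ (y j) - ℓ (x i) - ℓ (y j - w) =
        (ℓ (x i - w) - ℓ (x i)) + -(ℓ (y j - w) - ℓ (y j)) by ring, mul_add, Complex.exp_add,
      show x i - y j + κ * w = κ * w + x i - y j by ring]
    field_simp
  have hF := frobenius_det (Θ := fun z => theta α β z τ) (K := fun z => primeK z τ)
    (differentiable_theta α β τ).continuous (dense_theta_ne_zero α β τ) (fun z => primeK_neg z τ)
    (theta_primeK_relation α β τ) n x y hK (κ * w)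
  rw [hM, Matrix.det_mul_column, Matrix.det_mul_row, Finset.prod_mul_distrib, Finset.prod_const,
    Finset.card_univ, Fintype.card_fin]
  simp only [twist, Finset.prod_mul_distrib]
  beta_reduce at hF
  rw [inv_pow]
  generalize (∏ i, Complex.exp (κ * (logPrime (nome τ) (x i - w) - logPrime (nome τ) (x i)))) = r
  generalize (∏ i, Complex.exp (κ * (logPrime (nome τ) (y i) - logPrime (nome τ) (y i - w)))) = s
  field_simp
  linear_combination r * s * hF

end Szego

end TorusIntertwiner

theorem proposition5 (α₁ β₁ : ℝ) (τ : UpperHalfPlane) (κ : ℝ)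
    (hκ : κ ∈ Set.Ioo (-(1 / 2) : ℝ) (1 / 2)) (w : ℂ)
    (hθ : TorusIntertwiner.theta α₁ β₁ ((κ : ℂ) * w) τ ≠ 0)
    (n : ℕ) (x y : Fin n → ℂ)
    -- radial ordering `|q|⁻¹ > |e^{x₁}| > |e^{y₁}| > ⋯ > |e^{x_n}| > |e^{y_n}| > |e^w| > 1`
    (hw₀ : 0 < w.re) (hwτ : w.re < 2 * Real.pi * τ.im)
    (hxτ : ∀ i, (x i).re < 2 * Real.pi * τ.im)
    (hxy : ∀ i, (y i).re < (x i).re)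
    (hyx : ∀ i j, i < j → (x j).re < (y i).re)
    (hyw : ∀ i, w.re < (y i).re) :
    -- the series defining both intertwining functions converge absolutely
    Summable (TorusIntertwiner.traceTerm α₁ β₁ τ
      (TorusIntertwiner.generatingInsertions κ w x y)) ∧
    Summable (TorusIntertwiner.traceTerm α₁ β₁ τ (TorusIntertwiner.basicInsertions κ w)) ∧
    -- the branch of the `κ`-th power in `S_κ` exists, and the determinant formula holds for it
    (∃ ℓ : ℂ → ℂ, TorusIntertwiner.IsLogTheta1 τ ℓ) ∧
    ∀ ℓ : ℂ → ℂ, TorusIntertwiner.IsLogTheta1 τ ℓ →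
      TorusIntertwiner.generatingForm α₁ β₁ τ κ w x y =
        MvPolynomial.C (TorusIntertwiner.torusFn α₁ β₁ τ
          (TorusIntertwiner.basicInsertions κ w)) *
        (TorusIntertwiner.szegoMatrix ℓ α₁ β₁ τ κ w x y).det := by
  open TorusIntertwiner in
  have hD : InDomain τ w x y := ⟨hw₀, hwτ, hxτ, hxy, hyx, hyw⟩
  have hD0 : InDomain τ w (n := 0) Fin.elim0 Fin.elim0 :=
    ⟨hw₀, hwτ, fun i => i.elim0, fun i => i.elim0, fun i => i.elim0, fun i => i.elim0⟩
  have h1 := hasSum_traceTerm α₁ β₁ τ (chargeSum_generatingInsertions κ w x y)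
    (hD.radiallyOrdered κ)
  -- the insertions at `w` and `0` alone are the case `n = 0`
  have h2 := hasSum_traceTerm α₁ β₁ τ (chargeSum_generatingInsertions κ w Fin.elim0 Fin.elim0)
    (hD0.radiallyOrdered κ)
  have hs := sum_map_generatingInsertions κ w id x y
  have hs0 := sum_map_generatingInsertions κ w id Fin.elim0 Fin.elim0
  simp only [id_eq, sub_zero, Finset.univ_eq_empty, Finset.sum_empty, zero_add] at hs hs0
  rw [hs, exp_pairSum_generatingInsertions κ hD] at h1
  rw [hs0, generatingInsertions_zero] at h2
  refine ⟨h1.summable, h2.summable, exists_isLogTheta1 τ, fun ℓ hℓ => ?_⟩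
  rw [generatingForm, torusFn, torusFn, h1.tsum_eq, h2.tsum_eq, det_szegoMatrix,
    ← mul_assoc (MvPolynomial.C _), ← MvPolynomial.C_mul]
  congr 2
  rw [add_comm (∑ i, (x i - y i))]
  set E := Complex.exp (pairSum (fun a b => a.1 * b.1 * logPrime (nome τ) (a.2 - b.2))
    (basicInsertions κ w))
  linear_combination (-vacuumFactor τ * E) * det_szego hD hθ hℓ
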